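/- Let $F$ be an algebraically closed field, let $m$ be a natural number and $G=GL(m,F)$. Let $\mathbf{x}=(x^i_{j,k})_{i,j,k=1,\dots,m}$ be $m^3$ independent variables over $F$, regarded as an $m\times m^2$ matrix (rows indexed by the upper index $i$, columns by the pair $(j,k)$ of lower indices). The group $G$ acts on $m\times m^2$ matrices by $\tau(g,A)=gA(g^{-1}\otimes g^{-1})$, and $F(\mathbf{x})^G$ is the field of all $f\in F(\mathbf{x})$ such that $f(\tau(g,\mathbf{x}))=f(\mathbf{x})$ for every $g\in G$. For $k\ge 1$, a complete contraction of $A^{\otimes k}$ is obtained by contracting its $k$ upper indices with $k$ of its $2k$ lower indices (by any matching) and listing the $k$ remaining lower indices in any order; it is a row with $m^k$ entries. Let $\mathrm{Tr}_1(A)$ be the row with entries $\sum_j A^j_{j,i}$, $i=1,\dots,m$. Call a matrix $P(\mathbf{x})\in GL(m,F(\mathbf{x}))$ admissible of degree $k$ if - $k=1$ and every row of $P(\mathbf{x})$ is a complete contraction of $\mathbf{x}$; or - $k\ge 2$ and there are $m^k$ complete contractions of $\mathbf{x}^{\otimes k}$ forming the rows of a nonsingular $m^k\times m^k$ matrix $Q(\mathbf{x})$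 such that $P(\mathbf{x})^{-1}$ is a nonsingular $m\times m$ matrix formed by $m$ different columns of $(\mathbf{x}\otimes \mathrm{Tr}_1(\mathbf{x})^{\otimes (k-2)})\,Q(\mathbf{x})^{-1}$. **Theorem.** For all sufficiently large $k$ (depending on $m$ and $F$) there is an admissible $P(\mathbf{x})$ of degree $k$. For every $k$ and every admissible $P(\mathbf{x})$ of degree $k$, the field $F(\mathbf{x})^G$ is generated over $F$ by the entries of $P(\mathbf{x})\,\mathbf{x}\,(P(\mathbf{x})^{-1}\otimes P(\mathbf{x})^{-1})$, that is, $$F(\mathbf{x})^G=F\big(P(\mathbf{x})\,\mathbf{x}\,(P(\mathbf{x})^{-1}\otimes P(\mathbf{x})^{-1})\big).$$ -/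

import Mathlib

open scoped Kronecker

namespace StructureConstants

/-- The transformation law of structure constants under a change of basis,
`τ(g, A) = g A (g⁻¹ ⊗ g⁻¹)`, for `A ∈ Mat(m × m²; R)`; the column index `(j, k)` of `A` is the
pair of lower indices, the row index is the upper index. -/
def tau {R : Type*} [CommRing R] {m : ℕ} (g : Matrix.GeneralLinearGroup (Fin m) R)
    (A : Matrix (Fin m) (Fin m × Fin m) R) : Matrix (Fin m) (Fin m × Fin m) R :=
  (g : Matrix (Fin m) (Fin m) R) * A *
    (((g⁻¹ : Matrix.GeneralLinearGroup (Fin m) R) : Matrix (Fin m) (Fin m) R) ⊗ₖ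
      ((g⁻¹ : Matrix.GeneralLinearGroup (Fin m) R) : Matrix (Fin m) (Fin m) R))

theorem tau_one {R : Type*} [CommRing R] {m : ℕ} (A : Matrix (Fin m) (Fin m × Fin m) R) :
    tau 1 A = A := by
  simp [tau]

theorem tau_mul {R : Type*} [CommRing R] {m : ℕ} (g h : Matrix.GeneralLinearGroup (Fin m) R)
    (A : Matrix (Fin m) (Fin m × Fin m) R) : tau (g * h) A = tau g (tau h A) := by
  simp only [tau, mul_inv_rev, Units.val_mul, Matrix.mul_kronecker_mul, Matrix.mul_assoc]

theorem tau_map {R S : Type*} [CommRing R] [CommRing S] {m : ℕ} (φ : R →+* S)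
    (g : Matrix.GeneralLinearGroup (Fin m) R) (A : Matrix (Fin m) (Fin m × Fin m) R) :
    (tau g A).map φ = tau (Matrix.GeneralLinearGroup.map φ g) (A.map φ) := by
  have hinv : (((Matrix.GeneralLinearGroup.map φ g)⁻¹ : Matrix.GeneralLinearGroup (Fin m) S) :
      Matrix (Fin m) (Fin m) S) =
      ((g⁻¹ : Matrix.GeneralLinearGroup (Fin m) R) : Matrix (Fin m) (Fin m) R).map φ := by
    rw [← map_inv]; rfl
  have hval : ((Matrix.GeneralLinearGroup.map φ g : Matrix.GeneralLinearGroup (Fin m) S) :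
      Matrix (Fin m) (Fin m) S) = (g : Matrix (Fin m) (Fin m) R).map φ := rfl
  have hk (B : Matrix (Fin m) (Fin m) R) : (B ⊗ₖ B).map φ = B.map φ ⊗ₖ B.map φ := by
    ext ⟨a, b⟩ ⟨c, d⟩
    simp [Matrix.kroneckerMap_apply]
  rw [tau, tau, hinv, hval, Matrix.map_mul, Matrix.map_mul, hk]

/-- The polynomial ring `F[x]` in the `m³` variables `x^i_{j,k}`. -/
abbrev Poly (F : Type*) [Field F] (m : ℕ) : Type _ := MvPolynomial (Fin m × Fin m × Fin m) F

/-- The field `F(x)` of rational functions in the `m³` variables `x^i_{j,k}`. -/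
abbrev RatFun (F : Type*) [Field F] (m : ℕ) : Type _ := FractionRing (Poly F m)

/-- The variable matrix `x = (x^i_{j,k})` with entries in `F[x]`. -/
noncomputable def polyX (F : Type*) [Field F] (m : ℕ) :
    Matrix (Fin m) (Fin m × Fin m) (Poly F m) :=
  Matrix.of fun i p => MvPolynomial.X (i, p.1, p.2)

/-- The variable matrix `x = (x^i_{j,k})` with entries in `F(x)`. -/
noncomputable def genX (F : Type*) [Field F] (m : ℕ) :
    Matrix (Fin m) (Fin m × Fin m) (RatFun F m) :=
  (polyX F m).map (algebraMap (Poly F m) (RatFun F m))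

/-- The substitution `p(x) ↦ p(τ(g, x))` on `F[x]`, as an algebra homomorphism. -/
noncomputable def substHom {F : Type*} [Field F] {m : ℕ}
    (g : Matrix.GeneralLinearGroup (Fin m) F) : Poly F m →ₐ[F] Poly F m :=
  MvPolynomial.aeval fun q =>
    tau (Matrix.GeneralLinearGroup.map (algebraMap F (Poly F m)) g) (polyX F m) q.1 (q.2.1, q.2.2)

theorem polyX_map_substHom {F : Type*} [Field F] {m : ℕ}
    (g : Matrix.GeneralLinearGroup (Fin m) F) :
    (polyX F m).map (substHom g : Poly F m →+* Poly F m) =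
      tau (Matrix.GeneralLinearGroup.map (algebraMap F (Poly F m)) g) (polyX F m) := by
  ext1 i p
  simp [polyX, substHom]

theorem substHom_comp {F : Type*} [Field F] {m : ℕ}
    (g h : Matrix.GeneralLinearGroup (Fin m) F) (hgh : g * h = 1) :
    (substHom h).comp (substHom g) = AlgHom.id F (Poly F m) := by
  apply MvPolynomial.algHom_ext
  rintro ⟨i, j, k⟩
  have hC : Matrix.GeneralLinearGroup.map (substHom h : Poly F m →+* Poly F m)
      (Matrix.GeneralLinearGroup.map (algebraMap F (Poly F m)) g) =
      Matrix.GeneralLinearGroup.map (algebraMap F (Poly F m)) g := by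
    apply Units.ext
    ext1 a b
    exact (substHom h).commutes _
  have key := tau_map (substHom h : Poly F m →+* Poly F m)
    (Matrix.GeneralLinearGroup.map (algebraMap F (Poly F m)) g) (polyX F m)
  rw [hC, polyX_map_substHom, ← tau_mul, ← map_mul, hgh, map_one, tau_one] at key
  have := congrFun (congrFun key i) (j, k)
  simpa [substHom, polyX] using this

/-- The substitution `p(x) ↦ p(τ(g, x))` on `F[x]`, as an automorphism. -/
noncomputable def substPoly {F : Type*} [Field F] {m : ℕ}
    (g : Matrix.GeneralLinearGroup (Fin m) F) : Poly F m ≃ₐ[F] Poly F m :=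
  AlgEquiv.ofAlgHom (substHom g) (substHom g⁻¹)
    (substHom_comp _ _ (inv_mul_cancel g)) (substHom_comp _ _ (mul_inv_cancel g))

/-- The substitution `f(x) ↦ f(τ(g, x))` on the field `F(x)`. -/
noncomputable def substRat {F : Type*} [Field F] {m : ℕ}
    (g : Matrix.GeneralLinearGroup (Fin m) F) : RatFun F m ≃ₐ[F] RatFun F m :=
  IsFractionRing.fieldEquivOfAlgEquiv F (RatFun F m) (RatFun F m) (substPoly g)

/-- The field `F(x)^G`, `G = GL(m, F)`, of all rational functions `f` with `f(x) = f(τ(g, x))` for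
every `g ∈ G`. -/
noncomputable def invariantField (F : Type*) [Field F] (m : ℕ) :
    IntermediateField F (RatFun F m) where
  carrier := {f | ∀ g : Matrix.GeneralLinearGroup (Fin m) F, substRat g f = f}
  mul_mem' ha hb g := by rw [map_mul, ha g, hb g]
  add_mem' ha hb g := by rw [map_add, ha g, hb g]
  algebraMap_mem' r g := (substRat g).commutes r
  inv_mem' a ha g := by rw [map_inv₀, ha g]

/-- A complete contraction of the `k` upper indices of `A^{⊗k}` with `k` of its `2k` lower indices.
`(s, 0)` and `(s, 1)` are the first and the second lower index of the `s`-th factor. The value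
`inl u` means that this lower index is contracted with the upper index of the `u`-th factor, and
`inr p` that it remains, as the `p`-th of the `k` remaining lower indices. -/
abbrev Contraction (k : ℕ) : Type := Fin k × Fin 2 ≃ Fin k ⊕ Fin k

/-- The row with `m^k` entries (indexed by `J = (J_1, …, J_k)`) obtained from `A^{⊗k}` by the
contraction `c`; `I` collects the summation indices, one for each upper index. -/
def contract {R : Type*} [CommRing R] {m k : ℕ} (A : Matrix (Fin m) (Fin m × Fin m) R)
    (c : Contraction k) (J : Fin k → Fin m) : R :=
  ∑ I : Fin k → Fin m, ∏ s : Fin k,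
    A (I s) (Sum.elim I J (c (s, 0)), Sum.elim I J (c (s, 1)))

/-- The `m^k × m^k` matrix `Q(A)` whose rows are the chosen contractions of `A^{⊗k}`. -/
def contractionMatrix {R : Type*} [CommRing R] {m k : ℕ}
    (A : Matrix (Fin m) (Fin m × Fin m) R) (c : (Fin k → Fin m) → Contraction k) :
    Matrix (Fin k → Fin m) (Fin k → Fin m) R :=
  Matrix.of fun r J => contract A (c r) J

/-- `Tr₁(A)`, the row with entries `∑ j, A^j_{j,i}`. -/
def tr₁ {R : Type*} [CommRing R] {m : ℕ} (A : Matrix (Fin m) (Fin m × Fin m) R) (i : Fin m) : R :=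
  ∑ j, A j (j, i)

/-- The `m × m^k` matrix `A ⊗ Tr₁(A)^{⊗(k-2)}`, where `k = n + 2`. -/
def tensorTr {R : Type*} [CommRing R] {m : ℕ} (A : Matrix (Fin m) (Fin m × Fin m) R) (n : ℕ) :
    Matrix (Fin m) (Fin (n + 2) → Fin m) R :=
  Matrix.of fun i J => A i (J 0, J 1) * ∏ s : Fin n, tr₁ A (J s.succ.succ)

/-- `IsFrame F m k P` says that `P = P(x) ∈ GL(m, F(x))` arises from contractions of `x^{⊗k}`:
* for `k = 1`, the rows of `P(x)` are contractions of `x` (this can happen for `m ≤ 2` only);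
* for `k = n + 2`, `P(x)⁻¹` is a nonsingular `m × m` submatrix, formed by `m` columns, of
  `(x ⊗ Tr₁(x)^{⊗(k-2)}) Q(x)⁻¹`, where the rows of the nonsingular matrix `Q(x)` are `m^k`
  contractions of `x^{⊗k}`. -/
inductive IsFrame (F : Type*) [Field F] (m : ℕ) :
    ℕ → Matrix.GeneralLinearGroup (Fin m) (RatFun F m) → Prop
  | one (c : Fin m → Contraction 1) (P : Matrix.GeneralLinearGroup (Fin m) (RatFun F m))
      (hP : ∀ r i, (P : Matrix (Fin m) (Fin m) (RatFun F m)) r i =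
        contract (genX F m) (c r) (fun _ => i)) :
      IsFrame F m 1 P
  | add_two (n : ℕ) (c : (Fin (n + 2) → Fin m) → Contraction (n + 2))
      (hQ : (contractionMatrix (genX F m) c).det ≠ 0)
      (e : Fin m ↪ (Fin (n + 2) → Fin m))
      (P : Matrix.GeneralLinearGroup (Fin m) (RatFun F m))
      (hP : ((P⁻¹ : Matrix.GeneralLinearGroup (Fin m) (RatFun F m)) :
          Matrix (Fin m) (Fin m) (RatFun F m)) =
        (tensorTr (genX F m) n * (contractionMatrix (genX F m) c)⁻¹).submatrix id e) :
      IsFrame F m (n + 2) P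

end StructureConstants

namespace StructureConstants

/-! Generation. Under x ↦ τ(g, x) the matrix Q(x) is multiplied on the right by a Kronecker power of
g⁻¹. The matrix x ⊗ Tr₁(x)^{⊗(k-2)} acquires the same right factor and a left factor g. Hence P(x)
becomes P(x)g⁻¹, and τ(P, x) is invariant (`isFrame_map_substRat`). Conversely, the identity f(τ(g,
x)) = f(x), with denominators cleared, is polynomial in g up to powers of det g. As F is infinite,
it passes from g over F to g over F(x), and g = P, moved by a constant matrix to avoid zeros of the
denominator, expresses f through τ(P, x) (`invariantField_le_adjoin`).

Existence. It suffices that for large k the contractions of A^{⊗k} span all rows for one algebra A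
over one extension L of F, since a determinant that is nonzero at A is nonzero generically. Take L =
F(t), lam_i = t^i and the product (vw)_i = v_i(w_i + d_i lam(w)) on L^m, where d_i = 1 - 1/lam_i.
View contractions as multilinear forms on labelled slots; their span is closed under products on
disjoint slots and under v_b ↦ v_b v_n. Write p_w(U) for ∑_i w_i ∏_{b∈U} v_b(i). Traces of
multiplications put p_lam({b}) and p_1(U) into the span, and products of m forms p_lam(S) can be
multiplied by any coordinate of a further slot (`eval_mul_powProd_mem`). So it remains to produce
many factors p_lam(S) out of a long word ∏ v_b(x_b). This is possible because every word on more
than m² slots lies in the ideal generated by these forms (`wordForm_mem_powIdeal`), which is seen by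
letting t tend to 0: suitable elements of the ideal degenerate to a unitriangular system in the
words. -/

/-! ### Contractions under change of basis -/

theorem tau_apply {R : Type*} [CommRing R] {m : ℕ} (g : Matrix.GeneralLinearGroup (Fin m) R)
    (A : Matrix (Fin m) (Fin m × Fin m) R) (i j k : Fin m) :
    tau g A i (j, k) = ∑ a, ∑ b : Fin 2 → Fin m, g i a * A a (b 0, b 1) *
      ((g⁻¹ : Matrix.GeneralLinearGroup (Fin m) R) (b 0) j *
        (g⁻¹ : Matrix.GeneralLinearGroup (Fin m) R) (b 1) k) := by
  rw [tau, Matrix.mul_apply]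
  simp_rw [Matrix.mul_apply, Finset.sum_mul, Matrix.kroneckerMap_apply]
  rw [Finset.sum_comm]
  refine Finset.sum_congr rfl fun a _ => ?_
  refine (Fintype.sum_equiv (finTwoArrowEquiv (Fin m)) _ _ fun b => ?_).symm
  simp [finTwoArrowEquiv]

/-- At each contracted pair the g on the upper index cancels the g⁻¹ on the lower one; only the g⁻¹
on the free lower indices survive. -/
theorem contract_tau {R : Type*} [CommRing R] {m k : ℕ} (g : Matrix.GeneralLinearGroup (Fin m) R)
    (A : Matrix (Fin m) (Fin m × Fin m) R) (c : Contraction k) (J : Fin k → Fin m) :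
    contract (tau g A) c J = ∑ J' : Fin k → Fin m, contract A c J' *
      ∏ p, (g⁻¹ : Matrix.GeneralLinearGroup (Fin m) R) (J' p) (J p) := by
  set h : Matrix (Fin m) (Fin m) R :=
    ((g⁻¹ : Matrix.GeneralLinearGroup (Fin m) R) : Matrix (Fin m) (Fin m) R)
    with hh
  have hgh (b a : Fin m) : ∑ i, h b i * (g : Matrix (Fin m) (Fin m) R) i a =
      if b = a then 1 else 0 := by
    rw [← Matrix.mul_apply, ← Matrix.one_apply, hh, ← Units.val_mul, inv_mul_cancel, Units.val_one]
  have step1 (I : Fin k → Fin m) :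
      ∏ s, tau g A (I s) (Sum.elim I J (c (s, 0)), Sum.elim I J (c (s, 1))) =
      ∑ a : Fin k → Fin m, ∑ B : Fin k ⊕ Fin k → Fin m,
        (∏ s, A (a s) (B (c (s, 0)), B (c (s, 1)))) * (∏ s, g (I s) (a s)) *
        ((∏ u, h (B (Sum.inl u)) (I u)) * ∏ p, h (B (Sum.inr p)) (J p)) := by
    simp_rw [tau_apply, Finset.prod_univ_sum, Fintype.piFinset_univ]
    refine Finset.sum_congr rfl fun a _ => ?_
    refine Fintype.sum_equiv ((Equiv.curry _ _ _).symm.trans (Equiv.arrowCongr c (Equiv.refl _)))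
      _ _ fun B => ?_
    have key : (∏ u, h (B (c.symm (Sum.inl u)).1 (c.symm (Sum.inl u)).2) (I u)) *
        ∏ p, h (B (c.symm (Sum.inr p)).1 (c.symm (Sum.inr p)).2) (J p) =
        ∏ s, (h (B s 0) (Sum.elim I J (c (s, 0))) * h (B s 1) (Sum.elim I J (c (s, 1)))) := by
      have := Fintype.prod_sum_type fun z : Fin k ⊕ Fin k =>
        h (B (c.symm z).1 (c.symm z).2) (Sum.elim I J z)
      simp only [Sum.elim_inl, Sum.elim_inr] at this
      rw [← this, ← Equiv.prod_comp c, Fintype.prod_prod_type]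
      simp
    simp only [Equiv.trans_apply, Equiv.arrowCongr_apply, Equiv.coe_refl, Function.comp_apply, id,
      Equiv.curry_symm_apply, Function.uncurry, Equiv.symm_apply_apply]
    rw [key, ← Finset.prod_mul_distrib, ← Finset.prod_mul_distrib]
    refine Finset.prod_congr rfl fun s _ => ?_
    simp [hh]; ring
  unfold contract
  simp_rw [step1]
  rw [Finset.sum_comm]
  rw [Finset.sum_congr rfl fun a _ => Finset.sum_comm]
  -- Summing over the contracted labels I turns the factors g⁻¹g into Kronecker deltas, which force
  -- B to agree with a on the contracted indices.
  have step2 (a : Fin k → Fin m) (B : Fin k ⊕ Fin k → Fin m) :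
      ∑ I : Fin k → Fin m, (∏ s, A (a s) (B (c (s, 0)), B (c (s, 1)))) * (∏ s, g (I s) (a s)) *
        ((∏ u, h (B (Sum.inl u)) (I u)) * ∏ p, h (B (Sum.inr p)) (J p)) =
      if (fun u => B (Sum.inl u)) = a then
        (∏ s, A (a s) (B (c (s, 0)), B (c (s, 1)))) * ∏ p, h (B (Sum.inr p)) (J p) else 0 := by
    have : ∏ u, ∑ i, h (B (Sum.inl u)) i * (g : Matrix (Fin m) (Fin m) R) i (a u) =
        if (fun u => B (Sum.inl u)) = a then 1 else 0 := by
      simp_rw [hgh]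
      split_ifs with H
      · refine Finset.prod_eq_one fun u _ => ?_
        rw [if_pos (congrFun H u)]
      · obtain ⟨u, hu⟩ := Function.ne_iff.mp H
        exact Finset.prod_eq_zero (Finset.mem_univ u) (if_neg hu)
    rw [Finset.prod_univ_sum, Fintype.piFinset_univ] at this
    rw [← mul_ite_zero, ← mul_one (∏ p, h (B (Sum.inr p)) (J p)), ← mul_ite_zero, ← this,
      Finset.mul_sum, Finset.mul_sum]
    refine Finset.sum_congr rfl fun I _ => ?_
    rw [Finset.prod_mul_distrib]; ring
  rw [Finset.sum_congr rfl fun a _ => Finset.sum_congr rfl fun B _ => step2 a B, Finset.sum_comm]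
  simp only [Finset.sum_ite_eq, Finset.mem_univ, if_true]
  simp_rw [Finset.sum_mul]
  rw [Finset.sum_comm, ← Fintype.sum_prod_type']
  refine Fintype.sum_equiv (Equiv.sumArrowEquivProdArrow _ _ _) _ _ fun B => ?_
  have hB : Sum.elim (fun u => B (Sum.inl u)) (fun p => B (Sum.inr p)) = B := by
    ext z; cases z <;> rfl
  simp only [Equiv.sumArrowEquivProdArrow, Equiv.coe_fn_mk, Function.comp_def]
  rw [hB]

theorem contract_map {R S : Type*} [CommRing R] [CommRing S] {m k : ℕ} (φ : R →+* S)
    (A : Matrix (Fin m) (Fin m × Fin m) R) (c : Contraction k) (J : Fin k → Fin m) :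
    contract (A.map φ) c J = φ (contract A c J) := by
  simp [contract]

theorem contractionMatrix_map {R S : Type*} [CommRing R] [CommRing S] {m k : ℕ} (φ : R →+* S)
    (A : Matrix (Fin m) (Fin m × Fin m) R) (c : (Fin k → Fin m) → Contraction k) :
    contractionMatrix (A.map φ) c = (contractionMatrix A c).map φ := by
  ext r J
  simp [contractionMatrix, contract_map]

theorem tr₁_map {R S : Type*} [CommRing R] [CommRing S] {m : ℕ} (φ : R →+* S)
    (A : Matrix (Fin m) (Fin m × Fin m) R) (i : Fin m) : tr₁ (A.map φ) i = φ (tr₁ A i) := by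
  simp [tr₁]

theorem tensorTr_map {R S : Type*} [CommRing R] [CommRing S] {m : ℕ} (φ : R →+* S)
    (A : Matrix (Fin m) (Fin m × Fin m) R) (n : ℕ) :
    tensorTr (A.map φ) n = (tensorTr A n).map φ := by
  ext i J
  simp [tensorTr, tr₁_map]

/-- The `k`-th Kronecker power of a square matrix. -/
def kroneckerPow {R : Type*} [CommRing R] {m : ℕ} (h : Matrix (Fin m) (Fin m) R) (k : ℕ) :
    Matrix (Fin k → Fin m) (Fin k → Fin m) R :=
  Matrix.of fun J' J => ∏ p, h (J' p) (J p)

theorem contractionMatrix_tau {R : Type*} [CommRing R] {m k : ℕ}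
    (g : Matrix.GeneralLinearGroup (Fin m) R) (A : Matrix (Fin m) (Fin m × Fin m) R)
    (c : (Fin k → Fin m) → Contraction k) :
    contractionMatrix (tau g A) c = contractionMatrix A c *
      kroneckerPow ((g⁻¹ : Matrix.GeneralLinearGroup (Fin m) R) : Matrix (Fin m) (Fin m) R) k := by
  ext r J
  simp [contractionMatrix, contract_tau, kroneckerPow, Matrix.mul_apply]

theorem tr₁_tau {R : Type*} [CommRing R] {m : ℕ} (g : Matrix.GeneralLinearGroup (Fin m) R)
    (A : Matrix (Fin m) (Fin m × Fin m) R) (i : Fin m) :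
    tr₁ (tau g A) i = ∑ k, tr₁ A k * (g⁻¹ : Matrix.GeneralLinearGroup (Fin m) R) k i := by
  let c : Contraction 1 := (Equiv.prodComm _ _).trans <|
    (Equiv.prodCongr finTwoEquiv (Equiv.refl _)).trans (Equiv.boolProdEquivSum _)
  have hc (B : Matrix (Fin m) (Fin m × Fin m) R) (J : Fin 1 → Fin m) :
      contract B c J = tr₁ B (J 0) := by
    rw [contract, tr₁]
    refine Fintype.sum_equiv (Equiv.funUnique (Fin 1) (Fin m)) _ _ fun I => ?_
    simp [c, finTwoEquiv, Equiv.boolProdEquivSum]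
  have := contract_tau g A c (fun _ => i)
  simp only [hc] at this
  rw [this]
  refine Fintype.sum_equiv (Equiv.funUnique (Fin 1) (Fin m)) _ _ fun I => ?_
  simp

theorem sum_fin_add_two {R : Type*} [CommRing R] {m n : ℕ} (G : Fin m → Fin m → R)
    (f : Fin n → Fin m → R) :
    ∑ J : Fin (n + 2) → Fin m, G (J 0) (J 1) * ∏ s : Fin n, f s (J s.succ.succ) =
      (∑ a, ∑ b, G a b) * ∏ s, ∑ x, f s x := by
  rw [Finset.prod_univ_sum, Fintype.piFinset_univ, ← Fintype.sum_prod_type', Finset.sum_mul_sum,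
    ← Fintype.sum_prod_type']
  refine (Fintype.sum_equiv (((Equiv.prodAssoc _ _ _).trans <| Equiv.prodCongr (Equiv.refl _)
    (Fin.consEquiv fun _ : Fin (n + 1) => Fin m)).trans
      (Fin.consEquiv fun _ : Fin (n + 2) => Fin m)) _ _ fun x => ?_).symm
  simp [Fin.consEquiv]

theorem tensorTr_tau {R : Type*} [CommRing R] {m : ℕ} (g : Matrix.GeneralLinearGroup (Fin m) R)
    (A : Matrix (Fin m) (Fin m × Fin m) R) (n : ℕ) :
    tensorTr (tau g A) n = (g : Matrix (Fin m) (Fin m) R) * tensorTr A n *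
      kroneckerPow ((g⁻¹ : Matrix.GeneralLinearGroup (Fin m) R) : Matrix (Fin m) (Fin m) R)
        (n + 2) := by
  rw [Matrix.mul_assoc]
  ext i J
  rw [Matrix.mul_apply]
  have (a : Fin m) : (tensorTr A n * kroneckerPow
      ((g⁻¹ : Matrix.GeneralLinearGroup (Fin m) R) : Matrix (Fin m) (Fin m) R) (n + 2)) a J =
      (∑ b, ∑ b', A a (b, b') * ((g⁻¹ : Matrix.GeneralLinearGroup (Fin m) R) b (J 0) *
        (g⁻¹ : Matrix.GeneralLinearGroup (Fin m) R) b' (J 1))) *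
        ∏ s : Fin n, tr₁ (tau g A) (J s.succ.succ) := by
    simp_rw [tr₁_tau]
    rw [← sum_fin_add_two (fun b b' => A a (b, b') *
      ((g⁻¹ : Matrix.GeneralLinearGroup (Fin m) R) b (J 0) *
        (g⁻¹ : Matrix.GeneralLinearGroup (Fin m) R) b' (J 1)))
      (fun s x => tr₁ A x * (g⁻¹ : Matrix.GeneralLinearGroup (Fin m) R) x (J s.succ.succ)),
      Matrix.mul_apply]
    refine Finset.sum_congr rfl fun J' _ => ?_
    simp only [tensorTr, kroneckerPow, Matrix.of_apply, Fin.prod_univ_succ (n := n + 1),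
      Fin.prod_univ_succ (n := n), Finset.prod_mul_distrib, Fin.succ_zero_eq_one]
    ring
  simp_rw [this, ← mul_assoc]
  rw [← Finset.sum_mul, tensorTr, Matrix.of_apply, tau_apply]
  congr 1
  refine Finset.sum_congr rfl fun a _ => ?_
  rw [Finset.mul_sum, ← Fintype.sum_equiv (finTwoArrowEquiv (Fin m)).symm (fun x =>
    (g : Matrix (Fin m) (Fin m) R) i a * (A a (x.1, x.2) *
     ((g⁻¹ : Matrix.GeneralLinearGroup (Fin m) R) x.1 (J 0) *
        (g⁻¹ : Matrix.GeneralLinearGroup (Fin m) R) x.2 (J 1)))) _ fun x => ?_,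
    Fintype.sum_prod_type]
  · simp only [Finset.mul_sum, mul_assoc]
  · simp [finTwoArrowEquiv, mul_assoc]

/-! ### Frames transform by right translation -/

variable {F : Type*} [Field F] {m : ℕ}

theorem substRat_algebraMap (g : Matrix.GeneralLinearGroup (Fin m) F) (p : Poly F m) :
    substRat g (algebraMap (Poly F m) (RatFun F m) p) =
      algebraMap (Poly F m) (RatFun F m) (substHom g p) := by
  simp [substRat, substPoly]

theorem genX_map_substRat (g : Matrix.GeneralLinearGroup (Fin m) F) :
    (genX F m).map (substRat g : RatFun F m →+* RatFun F m) =
      tau (Matrix.GeneralLinearGroup.map (algebraMap F (RatFun F m)) g) (genX F m) := by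
  have h1 : (genX F m).map (substRat g : RatFun F m →+* RatFun F m) =
      ((polyX F m).map (substHom g : Poly F m →+* Poly F m)).map
        (algebraMap (Poly F m) (RatFun F m)) := by
    ext i p
    simp [genX, substRat_algebraMap]
  rw [h1, polyX_map_substHom, tau_map, genX]
  congr 1

/-- For k ≥ 2 the Kronecker powers of g⁻¹ in the two factors of N Q⁻¹ cancel, leaving the left
factor g on P⁻¹. Taking columns commutes with left multiplication, so the choice of columns is
immaterial. -/
theorem isFrame_map_substRat {k : ℕ} {P : Matrix.GeneralLinearGroup (Fin m) (RatFun F m)}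
    (hP : IsFrame F m k P) (g : Matrix.GeneralLinearGroup (Fin m) F) :
    Matrix.GeneralLinearGroup.map (substRat g : RatFun F m →+* RatFun F m) P =
      P * (Matrix.GeneralLinearGroup.map (algebraMap F (RatFun F m)) g)⁻¹ := by
  set σ : RatFun F m →+* RatFun F m := (substRat g : RatFun F m →+* RatFun F m) with hσ
  set G := Matrix.GeneralLinearGroup.map (algebraMap F (RatFun F m)) g with hG
  have hX : (genX F m).map σ = tau G (genX F m) := genX_map_substRat g
  cases hP with
  | one c _ hP =>
    apply Units.ext
    ext r i
    have h1 : σ (P r i) = contract (tau G (genX F m)) (c r) (fun _ => i) := by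
      rw [hP, ← contract_map, hX]
    change σ (P r i) = _
    rw [h1, contract_tau, Units.val_mul, Matrix.mul_apply]
    refine Fintype.sum_equiv (Equiv.funUnique (Fin 1) (Fin m)) _ _ fun I => ?_
    have : I = fun _ => I 0 := by ext x; rw [Subsingleton.elim x 0]
    simp only [Equiv.funUnique_apply, hP, Fin.default_eq_zero, Finset.univ_unique,
      Finset.prod_singleton]
    rw [← this]
  | add_two n c hQ e _ hP =>
    have hM : (tensorTr (genX F m) n * (contractionMatrix (genX F m) c)⁻¹).map σ =
        (G : Matrix (Fin m) (Fin m) (RatFun F m)) *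
          (tensorTr (genX F m) n * (contractionMatrix (genX F m) c)⁻¹) := by
      set Q := contractionMatrix (genX F m) c with hQd
      set N := tensorTr (genX F m) n with hN
      set H := kroneckerPow ((G⁻¹ : Matrix.GeneralLinearGroup (Fin m) (RatFun F m)) :
        Matrix (Fin m) (Fin m) (RatFun F m)) (n + 2)
      have hNQ : N * Q⁻¹ * Q = N := by
        rw [Matrix.mul_assoc, Matrix.nonsing_inv_mul _ (isUnit_iff_ne_zero.mpr hQ), Matrix.mul_one]
      have hQσ : Q.map σ = Q * H := by
        rw [hQd, ← contractionMatrix_map, hX, contractionMatrix_tau]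
      have hNσ : N.map σ = (G : Matrix (Fin m) (Fin m) (RatFun F m)) * N * H := by
        rw [hN, ← tensorTr_map, hX, tensorTr_tau]
      have hu : IsUnit (Q * H).det := by
        rw [isUnit_iff_ne_zero, ← hQσ, ← RingHom.mapMatrix_apply, ← RingHom.map_det]
        exact (map_ne_zero σ).mpr hQ
      have h2 : (N * Q⁻¹).map σ * (Q * H) =
          (G : Matrix (Fin m) (Fin m) (RatFun F m)) * (N * Q⁻¹) * (Q * H) := by
        rw [← hQσ, ← Matrix.map_mul, hNQ, hQσ, hNσ]
        rw [Matrix.mul_assoc (G : Matrix (Fin m) (Fin m) (RatFun F m)) (N * Q⁻¹),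
          ← Matrix.mul_assoc (N * Q⁻¹), hNQ, ← Matrix.mul_assoc]
      have := congrArg (· * (Q * H)⁻¹) h2
      simpa only [Matrix.mul_assoc, Matrix.mul_nonsing_inv _ hu, Matrix.mul_one] using this
    have hinv : Matrix.GeneralLinearGroup.map σ P⁻¹ = G * P⁻¹ := by
      apply Units.ext
      rw [Units.val_mul, hP]
      ext i j
      have := congrFun (congrFun hM i) (e j)
      change σ ((P⁻¹ : Matrix.GeneralLinearGroup (Fin m) (RatFun F m)).val i j) = _
      rw [hP]
      exact this
    rw [← inv_inj, ← map_inv, hinv, mul_inv_rev, inv_inv]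

theorem tau_frame_mem_invariantField {k : ℕ} {P : Matrix.GeneralLinearGroup (Fin m) (RatFun F m)}
    (hP : IsFrame F m k P) (i : Fin m) (p : Fin m × Fin m) :
    tau P (genX F m) i p ∈ invariantField F m := by
  intro g
  have := tau_map (substRat g : RatFun F m →+* RatFun F m) P (genX F m)
  rw [isFrame_map_substRat hP, genX_map_substRat, ← tau_mul, inv_mul_cancel_right] at this
  exact congrFun (congrFun this i) p

/-! ### Zariski density and generation of the invariant field -/

/-- Polynomials in the entries of `τ(g, A)` are, up to a power of `det g`, polynomials in the entries
of `g`. -/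
theorem exists_eval_tau_eq {K : Type*} [Field K] {m : ℕ} (A : Matrix (Fin m) (Fin m × Fin m) K)
    (p : MvPolynomial (Fin m × Fin m × Fin m) K) :
    ∃ (N : ℕ) (q : MvPolynomial (Fin m × Fin m) K), ∀ g : Matrix.GeneralLinearGroup (Fin m) K,
      MvPolynomial.eval (fun x => g x.1 x.2) q =
        (g : Matrix (Fin m) (Fin m) K).det ^ N *
          MvPolynomial.eval (fun x => tau g A x.1 (x.2.1, x.2.2)) p := by
  have hdet (g : Matrix.GeneralLinearGroup (Fin m) K) : MvPolynomial.eval (fun x => g x.1 x.2)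
      (Matrix.det (Matrix.of fun i j : Fin m => (MvPolynomial.X (i, j) :
        MvPolynomial (Fin m × Fin m) K))) = (g : Matrix (Fin m) (Fin m) K).det := by
    rw [RingHom.map_det]
    congr 1
    ext i j
    simp
  induction p using MvPolynomial.induction_on with
  | C a => exact ⟨0, MvPolynomial.C a, fun g => by simp⟩
  | add p₁ p₂ h₁ h₂ =>
    obtain ⟨N₁, q₁, h₁⟩ := h₁
    obtain ⟨N₂, q₂, h₂⟩ := h₂
    refine ⟨N₁ + N₂, Matrix.det (Matrix.of fun i j => MvPolynomial.X (i, j)) ^ N₂ * q₁ +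
      Matrix.det (Matrix.of fun i j => MvPolynomial.X (i, j)) ^ N₁ * q₂, fun g => ?_⟩
    rw [map_add, map_mul, map_mul, map_pow, map_pow, hdet, h₁, h₂, map_add]
    ring
  | mul_X p x h =>
    obtain ⟨N, q, h⟩ := h
    let G : Matrix (Fin m) (Fin m) (MvPolynomial (Fin m × Fin m) K) :=
      Matrix.of fun i j => MvPolynomial.X (i, j)
    let A' : Matrix (Fin m) (Fin m × Fin m) (MvPolynomial (Fin m × Fin m) K) :=
      A.map MvPolynomial.C
    let B : Matrix (Fin m) (Fin m × Fin m) (MvPolynomial (Fin m × Fin m) K) :=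
      G * A' * (G.adjugate ⊗ₖ G.adjugate)
    -- Each of the two copies of g⁻¹ is replaced by the adjugate, at the cost of one factor det g.
    refine ⟨N + 2, q * B x.1 (x.2.1, x.2.2), fun g => ?_⟩
    have hG : G.map (MvPolynomial.eval fun x : Fin m × Fin m => g x.1 x.2) =
        (g : Matrix (Fin m) (Fin m) K) := by
      ext i j
      simp [G]
    have hadj : G.adjugate.map (MvPolynomial.eval fun x : Fin m × Fin m => g x.1 x.2) =
        (g : Matrix (Fin m) (Fin m) K).det •
          ((g⁻¹ : Matrix.GeneralLinearGroup (Fin m) K) : Matrix (Fin m) (Fin m) K) := by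
      rw [← RingHom.mapMatrix_apply, RingHom.map_adjugate, RingHom.mapMatrix_apply, hG,
        Matrix.coe_units_inv, Matrix.inv_def, smul_smul, Ring.mul_inverse_cancel _
          ((Matrix.isUnit_iff_isUnit_det _).mp g.isUnit), one_smul]
    have hk (B : Matrix (Fin m) (Fin m) (MvPolynomial (Fin m × Fin m) K))
        (φ : MvPolynomial (Fin m × Fin m) K →+* K) :
        (B ⊗ₖ B).map φ = B.map φ ⊗ₖ B.map φ := by
      ext ⟨a, b⟩ ⟨c, d⟩
      simp [Matrix.kroneckerMap_apply]
    have hx : MvPolynomial.eval (fun x : Fin m × Fin m => g x.1 x.2) (B x.1 (x.2.1, x.2.2)) =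
        (g : Matrix (Fin m) (Fin m) K).det ^ 2 * tau g A x.1 (x.2.1, x.2.2) := by
      have hA : A'.map (MvPolynomial.eval fun x : Fin m × Fin m => g x.1 x.2) =
          A := by
        ext i j
        simp [A']
      have := congrFun (congrFun (Matrix.map_mul (L := G * A')
        (M := G.adjugate ⊗ₖ G.adjugate)
        (f := MvPolynomial.eval fun x : Fin m × Fin m => g x.1 x.2)) x.1) (x.2.1, x.2.2)
      refine this.trans ?_
      rw [Matrix.map_mul, hk, hG, hadj, hA, Matrix.smul_kronecker, Matrix.kronecker_smul,
        Matrix.mul_smul, Matrix.mul_smul, Matrix.smul_apply, Matrix.smul_apply, tau, smul_smul,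
        smul_eq_mul, sq]
    rw [map_mul, h, hx, map_mul, MvPolynomial.eval_X]
    ring

/-- `GL(m, F)` is Zariski dense in `GL(m, K)` for every extension field `K` of the infinite field
`F`. -/
theorem eval_tau_eq_zero {F K : Type*} [Field F] [Infinite F] [Field K] [Algebra F K] {m : ℕ}
    (A : Matrix (Fin m) (Fin m × Fin m) K) (p : MvPolynomial (Fin m × Fin m × Fin m) K)
    (h : ∀ g : Matrix.GeneralLinearGroup (Fin m) F, MvPolynomial.eval (fun x =>
      tau (Matrix.GeneralLinearGroup.map (algebraMap F K) g) A x.1 (x.2.1, x.2.2)) p = 0)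
    (g : Matrix.GeneralLinearGroup (Fin m) K) :
    MvPolynomial.eval (fun x => tau g A x.1 (x.2.1, x.2.2)) p = 0 := by
  obtain ⟨N, q, hq⟩ := exists_eval_tau_eq A p
  let D : MvPolynomial (Fin m × Fin m) K :=
    Matrix.det (Matrix.of fun i j : Fin m => MvPolynomial.X (i, j))
  have hD (y : Fin m × Fin m → K) :
      MvPolynomial.eval y D = (Matrix.of fun i j => y (i, j)).det := by
    rw [RingHom.map_det]
    congr 1
    ext i j
    simp
  -- The factor D = det kills the singular points, about which the hypothesis says nothing; D is
  -- removed afterwards because D ≠ 0.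
  have h0 : q * D = 0 := by
    refine MvPolynomial.funext_set (fun _ => Set.range (algebraMap F K))
      (fun _ => Set.infinite_range_of_injective (algebraMap F K).injective) fun y hy => ?_
    choose z hz using fun i => hy i (Set.mem_univ i)
    have hyz : (Matrix.of fun i j => y (i, j)) =
        (Matrix.of fun i j => z (i, j) : Matrix (Fin m) (Fin m) F).map (algebraMap F K) := by
      ext i j
      simp [hz]
    rw [map_mul, map_zero, hD, hyz, ← RingHom.mapMatrix_apply, ← RingHom.map_det]
    by_cases hdet : (Matrix.of fun i j => z (i, j) : Matrix (Fin m) (Fin m) F).det = 0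
    · rw [hdet, map_zero, mul_zero]
    · let g₀ := Matrix.GeneralLinearGroup.mkOfDetNeZero _ hdet
      have h1 := hq (Matrix.GeneralLinearGroup.map (algebraMap F K) g₀)
      rw [h g₀, mul_zero] at h1
      have : (fun x : Fin m × Fin m => (Matrix.GeneralLinearGroup.map (algebraMap F K) g₀ :
          Matrix (Fin m) (Fin m) K) x.1 x.2) = y := by
        ext x
        exact hz x
      rw [this] at h1
      rw [h1, zero_mul]
  have hD0 : D ≠ 0 := by
    intro H
    have := hD fun x => (1 : Matrix (Fin m) (Fin m) K) x.1 x.2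
    rw [H, map_zero] at this
    change 0 = (1 : Matrix (Fin m) (Fin m) K).det at this
    simp at this
  have hq0 := (mul_eq_zero.mp h0).resolve_right hD0
  have h2 := hq g
  rw [hq0, map_zero] at h2
  exact (mul_eq_zero.mp h2.symm).resolve_left
    (pow_ne_zero _ ((Matrix.isUnit_iff_isUnit_det _).mp g.isUnit).ne_zero)

theorem substHom_eq_eval {F : Type*} [Field F] {m : ℕ}
    (g : Matrix.GeneralLinearGroup (Fin m) F) (p : Poly F m) :
    algebraMap (Poly F m) (RatFun F m) (substHom g p) = MvPolynomial.aeval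
      (fun x : Fin m × Fin m × Fin m => tau (Matrix.GeneralLinearGroup.map
        (algebraMap F (RatFun F m)) g) (genX F m) x.1 (x.2.1, x.2.2)) p := by
  rw [← genX_map_substRat]
  have : (IsScalarTower.toAlgHom F (Poly F m) (RatFun F m)).comp (substHom g) =
      MvPolynomial.aeval (fun x : Fin m × Fin m × Fin m =>
        (genX F m).map (substRat g : RatFun F m →+* RatFun F m) x.1 (x.2.1, x.2.2)) := by
    apply MvPolynomial.algHom_ext
    intro x
    simp [genX, polyX, substRat_algebraMap]
  exact congrArg (fun φ => φ p) this

theorem algebraMap_eq_aeval_genX {F : Type*} [Field F] {m : ℕ} (p : Poly F m) :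
    algebraMap (Poly F m) (RatFun F m) p = MvPolynomial.aeval
      (fun x : Fin m × Fin m × Fin m => genX F m x.1 (x.2.1, x.2.2)) p := by
  have : IsScalarTower.toAlgHom F (Poly F m) (RatFun F m) =
      MvPolynomial.aeval (fun x : Fin m × Fin m × Fin m => genX F m x.1 (x.2.1, x.2.2)) := by
    apply MvPolynomial.algHom_ext
    intro x
    simp [genX, polyX]
  exact congrArg (fun φ => φ p) this

/-- Every invariant rational function is a rational function of the entries of `τ(P, x)`, for any
`P ∈ GL(m, F(x))`. -/
theorem invariantField_le_adjoin {F : Type*} [Field F] [Infinite F] {m : ℕ}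
    (P : Matrix.GeneralLinearGroup (Fin m) (RatFun F m)) :
    invariantField F m ≤ IntermediateField.adjoin F (Set.range fun q : Fin m × Fin m × Fin m =>
      tau P (genX F m) q.1 (q.2.1, q.2.2)) := by
  intro f hf
  set E := IntermediateField.adjoin F (Set.range fun q : Fin m × Fin m × Fin m =>
      tau P (genX F m) q.1 (q.2.1, q.2.2)) with hE
  let ev (B : Matrix (Fin m) (Fin m × Fin m) (RatFun F m)) : Poly F m →ₐ[F] RatFun F m :=
    MvPolynomial.aeval fun x => B x.1 (x.2.1, x.2.2)
  have hev (B : Matrix (Fin m) (Fin m × Fin m) (RatFun F m)) (p : Poly F m) :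
      MvPolynomial.eval (fun x => B x.1 (x.2.1, x.2.2))
        (MvPolynomial.map (algebraMap F (RatFun F m)) p) = ev B p := by
    rw [MvPolynomial.eval_map]
    rfl
  obtain ⟨a, b, hb, rfl⟩ := IsFractionRing.div_surjective (A := Poly F m) f
  have hb0 : algebraMap (Poly F m) (RatFun F m) b ≠ 0 :=
    IsFractionRing.to_map_ne_zero_of_mem_nonZeroDivisors hb
  have key (g : Matrix.GeneralLinearGroup (Fin m) (RatFun F m)) :
      ev (tau g (genX F m)) a * algebraMap (Poly F m) (RatFun F m) b =
        algebraMap (Poly F m) (RatFun F m) a * ev (tau g (genX F m)) b := by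
    have := eval_tau_eq_zero (F := F) (genX F m)
      (MvPolynomial.map (algebraMap F (RatFun F m)) a *
        MvPolynomial.C (algebraMap (Poly F m) (RatFun F m) b) -
        MvPolynomial.C (algebraMap (Poly F m) (RatFun F m) a) *
          MvPolynomial.map (algebraMap F (RatFun F m)) b) (fun g₀ => ?_) g
    · rw [map_sub, map_mul, map_mul, hev, hev, MvPolynomial.eval_C, MvPolynomial.eval_C,
        sub_eq_zero] at this
      exact this
    · rw [map_sub, map_mul, map_mul, hev, hev, MvPolynomial.eval_C, MvPolynomial.eval_C,
        sub_eq_zero]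
      have h1 := hf g₀
      rw [map_div₀, substRat_algebraMap, substRat_algebraMap, substHom_eq_eval,
        substHom_eq_eval] at h1
      have h2 : ev (tau (Matrix.GeneralLinearGroup.map (algebraMap F (RatFun F m)) g₀)
          (genX F m)) b ≠ 0 := by
        change MvPolynomial.aeval _ b ≠ 0
        rw [← substHom_eq_eval, ← substRat_algebraMap]
        exact (map_ne_zero _).mpr hb0
      exact (div_eq_div_iff h2 hb0).mp h1
  -- The denominator b may vanish at τ(P, x). If it vanished at all τ(h, τ(P, x)) with h over F,
  -- density would allow h = P⁻¹ and give b = 0.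
  obtain ⟨h, hh⟩ : ∃ h : Matrix.GeneralLinearGroup (Fin m) F,
      ev (tau (Matrix.GeneralLinearGroup.map (algebraMap F (RatFun F m)) h)
        (tau P (genX F m))) b ≠ 0 := by
    by_contra! H
    have := eval_tau_eq_zero (F := F) (tau P (genX F m))
      (MvPolynomial.map (algebraMap F (RatFun F m)) b) (fun g₀ => by rw [hev, H]) P⁻¹
    rw [hev, ← tau_mul, inv_mul_cancel, tau_one] at this
    exact hb0 (by rw [algebraMap_eq_aeval_genX]; exact this)
  set G := Matrix.GeneralLinearGroup.map (algebraMap F (RatFun F m)) h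
  have hmem (p : Poly F m) : ev (tau G (tau P (genX F m))) p ∈ E := by
    have hy (i j k : Fin m) : tau P (genX F m) i (j, k) ∈ E :=
      IntermediateField.subset_adjoin _ _ ⟨(i, j, k), rfl⟩
    have hg (i j : Fin m) : (G : Matrix (Fin m) (Fin m) (RatFun F m)) i j ∈ E :=
      E.algebraMap_mem _
    have hg' (i j : Fin m) : ((G⁻¹ : Matrix.GeneralLinearGroup (Fin m) (RatFun F m)) :
        Matrix (Fin m) (Fin m) (RatFun F m)) i j ∈ E := by
      rw [← map_inv]
      exact E.algebraMap_mem _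
    have hz (i j k : Fin m) : tau G (tau P (genX F m)) i (j, k) ∈ E := by
      rw [tau_apply]
      exact sum_mem fun a _ => sum_mem fun c _ => mul_mem (mul_mem (hg _ _) (hy _ _ _))
        (mul_mem (hg' _ _) (hg' _ _))
    induction p using MvPolynomial.induction_on with
    | C r => rw [MvPolynomial.algHom_C]; exact E.algebraMap_mem r
    | add p q hp hq => rw [map_add]; exact add_mem hp hq
    | mul_X p x hp =>
      rw [map_mul, MvPolynomial.aeval_X]
      exact mul_mem hp (hz _ _ _)
  have h3 := key (G * P)
  rw [tau_mul] at h3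
  rw [(div_eq_div_iff hb0 hh).mpr h3.symm]
  exact div_mem (hmem a) (hmem b)

theorem invariantField_eq_adjoin {F : Type*} [Field F] [Infinite F] {m k : ℕ}
    {P : Matrix.GeneralLinearGroup (Fin m) (RatFun F m)} (hP : IsFrame F m k P) :
    invariantField F m = IntermediateField.adjoin F (Set.range fun q : Fin m × Fin m × Fin m =>
      tau P (genX F m) q.1 (q.2.1, q.2.2)) := by
  refine le_antisymm (invariantField_le_adjoin P) (IntermediateField.adjoin_le_iff.mpr ?_)
  rintro _ ⟨q, rfl⟩
  exact tau_frame_mem_invariantField hP _ _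

/-! ### Contractions as multilinear forms -/

/-- The multilinear form in `(v_b)_{b ∈ β}` obtained from a complete contraction of the tensor power
of `A` by pairing its remaining lower indices with the vectors `v_b`; the sum runs over all
labellings of the upper indices and of the remaining lower indices. -/
def wiring {R : Type*} [CommRing R] {m : ℕ} {β : Type*} [Fintype β] [DecidableEq β]
    (A : Matrix (Fin m) (Fin m × Fin m) R) (c : β × Fin 2 ≃ β ⊕ β) (v : β → Fin m → R) : R :=
  ∑ K : β ⊕ β → Fin m, (∏ a, A (K (Sum.inl a)) (K (c (a, 0)), K (c (a, 1)))) *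
    ∏ b, v b (K (Sum.inr b))

section Wiring

variable {R : Type*} [CommRing R] {m : ℕ} (A : Matrix (Fin m) (Fin m × Fin m) R)

theorem wiring_single {k : ℕ} (c : Contraction k) (J : Fin k → Fin m) :
    wiring A c (fun b => Pi.single (J b) 1) = contract A c J := by
  unfold wiring contract
  rw [Fintype.sum_equiv (Equiv.sumArrowEquivProdArrow _ _ _) _ (fun x =>
    (∏ a, A (x.1 a) (Sum.elim x.1 x.2 (c (a, 0)), Sum.elim x.1 x.2 (c (a, 1)))) *
      ∏ b, (Pi.single (J b) 1 : Fin m → R) (x.2 b)), Fintype.sum_prod_type]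
  · refine Finset.sum_congr rfl fun I _ => ?_
    rw [Finset.sum_eq_single J]
    · simp
    · intro J' _ hJ
      obtain ⟨b, hb⟩ := Function.ne_iff.mp hJ
      have : ∏ b, (Pi.single (J b) 1 : Fin m → R) (J' b) = 0 :=
        Finset.prod_eq_zero (Finset.mem_univ b) (Pi.single_eq_of_ne hb 1)
      dsimp only
      rw [this, mul_zero]
    · simp
  · intro K
    have hK : Sum.elim (fun u => K (Sum.inl u)) (fun p => K (Sum.inr p)) = K := by
      ext z; cases z <;> rfl
    simp only [Equiv.sumArrowEquivProdArrow, Equiv.coe_fn_mk, Function.comp_def]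
    rw [hK]

theorem wiring_reindex {β γ : Type*} [Fintype β] [DecidableEq β] [Fintype γ] [DecidableEq γ]
    (e : β ≃ γ) (c : β × Fin 2 ≃ β ⊕ β) (v : β → Fin m → R) :
    wiring A ((Equiv.prodCongr e.symm (Equiv.refl _)).trans (c.trans (Equiv.sumCongr e e)))
      (fun b => v (e.symm b)) = wiring A c v := by
  unfold wiring
  refine Fintype.sum_equiv ((Equiv.sumCongr e.symm e.symm).arrowCongr (Equiv.refl _)) _ _
    fun K => ?_
  rw [← e.prod_comp, ← e.prod_comp (fun b => v (e.symm b) (K (Sum.inr b)))]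
  simp

/-- A disjoint union of contraction diagrams evaluates to a product, since the sum over labellings
factors. -/
theorem wiring_sum {β γ : Type*} [Fintype β] [DecidableEq β] [Fintype γ] [DecidableEq γ]
    (c : β × Fin 2 ≃ β ⊕ β) (d : γ × Fin 2 ≃ γ ⊕ γ) (v : β → Fin m → R) (w : γ → Fin m → R) :
    wiring A ((Equiv.sumProdDistrib β γ (Fin 2)).trans
      ((Equiv.sumCongr c d).trans (Equiv.sumSumSumComm β β γ γ))) (Sum.elim v w) =
      wiring A c v * wiring A d w := by
  unfold wiring
  rw [Finset.sum_mul_sum, ← Fintype.sum_prod_type']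
  refine Fintype.sum_equiv (((Equiv.sumSumSumComm β γ β γ).arrowCongr (Equiv.refl _)).trans
    (Equiv.sumArrowEquivProdArrow _ _ _)) _ _ fun K => ?_
  have h1 (z : β ⊕ β) : K ((Equiv.sumSumSumComm β β γ γ) (Sum.inl z)) =
      K ((Equiv.sumSumSumComm β γ β γ).symm (Sum.inl z)) := by cases z <;> rfl
  have h2 (z : γ ⊕ γ) : K ((Equiv.sumSumSumComm β β γ γ) (Sum.inr z)) =
      K ((Equiv.sumSumSumComm β γ β γ).symm (Sum.inr z)) := by cases z <;> rfl
  simp only [Fintype.prod_sum_type, Equiv.trans_apply, Equiv.sumProdDistrib_apply_left,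
    Equiv.sumProdDistrib_apply_right, Equiv.sumCongr_apply, Sum.map_inl, Sum.map_inr, h1, h2,
    Sum.elim_inl, Sum.elim_inr, Equiv.sumArrowEquivProdArrow, Equiv.arrowCongr_apply,
    Equiv.coe_refl, Function.comp_def, id, Equiv.coe_fn_mk]
  simp only [Equiv.sumSumSumComm_symm, Equiv.sumSumSumComm_apply, Function.comp_def]
  simp
  ring

/-- The product of the algebra with structure constants `A`. -/
def algMul (v w : Fin m → R) (i : Fin m) : R := ∑ x, ∑ y, A i (x, y) * (v x * w y)

/-- Relabelling for `wiringSubst`: the free slot `b₀` becomes the output of the new vertex `none`,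
whose inputs are the free slots `some b₀` and `none`. -/
def substTarget {β : Type*} [DecidableEq β] (b₀ : β) :
    (β ⊕ β) ⊕ Fin 2 ≃ Option β ⊕ Option β :=
  ((Equiv.sumCongr (Equiv.refl _) (finTwoEquiv.trans Equiv.boolEquivPUnitSumPUnit)).trans <|
    (Equiv.sumSumSumComm β β Unit Unit).trans <|
      Equiv.sumCongr (Equiv.optionEquivSumPUnit β).symm (Equiv.optionEquivSumPUnit β).symm).trans
    (Equiv.swap (Sum.inl none) (Sum.inr (some b₀)))

/-- The contraction obtained by plugging the output of a new vertex into the free slot `b₀`. -/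
def wiringSubst {β : Type*} [DecidableEq β] (b₀ : β) (c : β × Fin 2 ≃ β ⊕ β) :
    Option β × Fin 2 ≃ Option β ⊕ Option β :=
  (Equiv.prodCongr (Equiv.optionEquivSumPUnit.{0} β) (Equiv.refl _)).trans <|
    (Equiv.sumProdDistrib _ _ _).trans <|
      (Equiv.sumCongr c (Equiv.punitProd _)).trans (substTarget b₀)

theorem wiring_wiringSubst {β : Type*} [Fintype β] [DecidableEq β] (b₀ : β)
    (c : β × Fin 2 ≃ β ⊕ β) (v : Option β → Fin m → R) :
    wiring A (wiringSubst b₀ c) v = wiring A c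
      (Function.update (fun b => v (some b)) b₀ (algMul A (v (some b₀)) (v none))) := by
  have t1 (a : β) : (substTarget b₀).symm (Sum.inl (some a)) = Sum.inl (Sum.inl a) := by
    rw [Equiv.symm_apply_eq]; simp [substTarget, Equiv.swap_apply_def]
  have t2 : (substTarget b₀).symm (Sum.inl none) = Sum.inl (Sum.inr b₀) := by
    rw [Equiv.symm_apply_eq]; simp [substTarget]
  have t3 (b : β) (hb : b ≠ b₀) :
      (substTarget b₀).symm (Sum.inr (some b)) = Sum.inl (Sum.inr b) := by
    rw [Equiv.symm_apply_eq]; simp [substTarget, Equiv.swap_apply_def, hb]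
  have t4 : (substTarget b₀).symm (Sum.inr (some b₀)) = Sum.inr 0 := by
    rw [Equiv.symm_apply_eq]
    simp [substTarget, finTwoEquiv, Equiv.boolEquivPUnitSumPUnit]
  have t5 : (substTarget b₀).symm (Sum.inr none) = Sum.inr 1 := by
    rw [Equiv.symm_apply_eq]
    simp [substTarget, Equiv.swap_apply_def, finTwoEquiv, Equiv.boolEquivPUnitSumPUnit]
  have c1 (a : β) (ε : Fin 2) : (substTarget b₀).symm (wiringSubst b₀ c (some a, ε)) =
      Sum.inl (c (a, ε)) := by simp [wiringSubst]
  have c2 (ε : Fin 2) : (substTarget b₀).symm (wiringSubst b₀ c (none, ε)) = Sum.inr ε := by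
    simp [wiringSubst]
  unfold wiring
  rw [Fintype.sum_equiv (((substTarget b₀).symm.arrowCongr (Equiv.refl _)).trans
    (Equiv.sumArrowEquivProdArrow _ _ _)) _ (fun x : (β ⊕ β → Fin m) × (Fin 2 → Fin m) =>
      (∏ a, A (x.1 (Sum.inl a)) (x.1 (c (a, 0)), x.1 (c (a, 1)))) *
      (A (x.1 (Sum.inr b₀)) (x.2 0, x.2 1) * (v (some b₀) (x.2 0) * v none (x.2 1))) *
        ∏ b ∈ Finset.univ.erase b₀, v (some b) (x.1 (Sum.inr b))), Fintype.sum_prod_type]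
  · refine Finset.sum_congr rfl fun K _ => ?_
    dsimp only
    rw [← Finset.sum_mul, ← Finset.mul_sum, ← Finset.mul_prod_erase _
      (fun b => Function.update (fun b => v (some b)) b₀
        (algMul A (v (some b₀)) (v none)) b (K (Sum.inr b))) (Finset.mem_univ b₀),
      Function.update_self, mul_assoc]
    congr 2
    · rw [algMul, ← Fintype.sum_prod_type']
      exact Fintype.sum_equiv (finTwoArrowEquiv (Fin m)) _ _ fun x => rfl
    · refine Finset.prod_congr rfl fun b hb => ?_
      rw [Function.update_of_ne (Finset.ne_of_mem_erase hb)]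
  · intro K
    obtain ⟨L, rfl⟩ : ∃ L : (β ⊕ β) ⊕ Fin 2 → Fin m, K = L ∘ (substTarget b₀).symm :=
      ⟨K ∘ substTarget b₀, by ext; simp⟩
    have h3 : ∏ b ∈ Finset.univ.erase b₀,
        v (some b) (L ((substTarget b₀).symm (Sum.inr (some b)))) =
        ∏ b ∈ Finset.univ.erase b₀, v (some b) (L (Sum.inl (Sum.inr b))) :=
      Finset.prod_congr rfl fun b hb => by rw [t3 b (Finset.ne_of_mem_erase hb)]
    simp only [Fintype.prod_option, Function.comp_apply, c1, c2, t1, t2, t5,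
      ← Finset.mul_prod_erase _ (fun b => v (some b) _) (Finset.mem_univ b₀), t4, h3,
      Equiv.trans_apply, Equiv.arrowCongr_apply, Equiv.symm_symm, Equiv.coe_refl, id,
      Equiv.sumArrowEquivProdArrow, Equiv.coe_fn_mk, Function.comp_def, Equiv.symm_apply_apply]
    ring

end Wiring

/-! ### The span of contractions and its closure properties -/

section FormSpace

variable {R : Type*} [CommRing R] {m : ℕ} (A : Matrix (Fin m) (Fin m × Fin m) R)

/-- The span of the complete contractions of the tensor powers of `A`, as multilinear forms in the
vectors `v_b` with `b ∈ s`. -/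
def formSpace (s : Finset ℕ) : Submodule R ((ℕ → Fin m → R) → R) :=
  Submodule.span R {φ | ∃ (k : ℕ) (c : Contraction k) (f : Fin k → ℕ), Function.Injective f ∧
    (∀ n, n ∈ s ↔ ∃ a, f a = n) ∧ φ = fun v => wiring A c fun b => v (f b)}

variable {A}

theorem wiring_mem_formSpace {β : Type*} [Fintype β] [DecidableEq β] (c : β × Fin 2 ≃ β ⊕ β)
    (f : β → ℕ) (hf : Function.Injective f) {s : Finset ℕ} (hs : ∀ n, n ∈ s ↔ ∃ a, f a = n) :
    (fun v => wiring A c fun b => v (f b)) ∈ formSpace A s := by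
  refine Submodule.subset_span ⟨Fintype.card β, (Equiv.prodCongr (Fintype.equivFin β).symm
    (Equiv.refl _)).trans (c.trans (Equiv.sumCongr (Fintype.equivFin β) (Fintype.equivFin β))),
    f ∘ (Fintype.equivFin β).symm, hf.comp (Equiv.injective _), fun n => ?_, ?_⟩
  · rw [hs]
    exact ⟨fun ⟨a, ha⟩ => ⟨Fintype.equivFin β a, by simpa using ha⟩, fun ⟨a, ha⟩ => ⟨_, ha⟩⟩
  · funext v
    exact (wiring_reindex A (Fintype.equivFin β) c fun b => v (f b)).symm

theorem mul_mem_formSpace {s t : Finset ℕ} (hst : Disjoint s t) {φ ψ : (ℕ → Fin m → R) → R}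
    (hφ : φ ∈ formSpace A s) (hψ : ψ ∈ formSpace A t) : φ * ψ ∈ formSpace A (s ∪ t) := by
  induction hφ using Submodule.span_induction with
  | zero => rw [zero_mul]; exact zero_mem _
  | add x y _ _ hx hy => rw [add_mul]; exact add_mem hx hy
  | smul a x _ hx => rw [smul_mul_assoc]; exact Submodule.smul_mem _ _ hx
  | mem x hx =>
    induction hψ using Submodule.span_induction with
    | zero => rw [mul_zero]; exact zero_mem _
    | add y z _ _ hy hz => rw [mul_add]; exact add_mem hy hz
    | smul a y _ hy => rw [mul_smul_comm]; exact Submodule.smul_mem _ _ hy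
    | mem y hy =>
      obtain ⟨k, c, f, hf, hs, rfl⟩ := hx
      obtain ⟨l, d, g, hg, ht, rfl⟩ := hy
      have hne (a : Fin k) (b : Fin l) : f a ≠ g b := fun h =>
        Finset.disjoint_left.mp hst ((hs _).mpr ⟨a, rfl⟩) ((ht _).mpr ⟨b, h.symm⟩)
      convert wiring_mem_formSpace (A := A) ((Equiv.sumProdDistrib _ _ (Fin 2)).trans
        ((Equiv.sumCongr c d).trans (Equiv.sumSumSumComm _ _ _ _))) (Sum.elim f g)
        (hf.sumElim hg hne) (s := s ∪ t) (fun n => by simp [hs, ht]) using 1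
      funext v
      rw [Pi.mul_apply, ← wiring_sum]
      congr 1
      ext z
      cases z <;> rfl

theorem subst_mem_formSpace {s : Finset ℕ} {b n : ℕ} (hb : b ∈ s) (hn : n ∉ s)
    {φ : (ℕ → Fin m → R) → R} (hφ : φ ∈ formSpace A s) :
    (fun v => φ (Function.update v b (algMul A (v b) (v n)))) ∈ formSpace A (insert n s) := by
  induction hφ using Submodule.span_induction with
  | zero => exact zero_mem _
  | add x y _ _ hx hy => exact add_mem hx hy
  | smul a x _ hx => exact Submodule.smul_mem _ a hx
  | mem x hx =>
    obtain ⟨k, c, f, hf, hs, rfl⟩ := hx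
    obtain ⟨b₀, rfl⟩ := (hs b).mp hb
    convert wiring_mem_formSpace (A := A) (wiringSubst b₀ c) (fun o => o.elim n f) ?_
      (s := insert n s) ?_ using 1
    · funext v
      rw [wiring_wiringSubst]
      dsimp only
      congr 1
      funext a
      by_cases ha : a = b₀
      · subst ha
        simp
      · rw [Function.update_of_ne ha, Function.update_of_ne (hf.ne ha)]
        rfl
    · rintro (_ | a) (_ | b) h
      · rfl
      · exact absurd ((hs n).mpr ⟨b, h.symm⟩) hn
      · exact absurd ((hs n).mpr ⟨a, h⟩) hn
      · exact congrArg some (hf h)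
    · intro x
      rw [Finset.mem_insert, hs, Option.exists]
      simp [eq_comm]

theorem congr_of_mem_formSpace {s : Finset ℕ} {φ : (ℕ → Fin m → R) → R}
    (hφ : φ ∈ formSpace A s) {v w : ℕ → Fin m → R} (h : ∀ b ∈ s, v b = w b) : φ v = φ w := by
  induction hφ using Submodule.span_induction with
  | zero => rfl
  | add x y _ _ hx hy => simp [hx, hy]
  | smul a x _ hx => simp [hx]
  | mem x hx =>
    obtain ⟨k, c, f, hf, hs, rfl⟩ := hx
    have : (fun b => v (f b)) = fun b => w (f b) := funext fun b => h _ ((hs _).mpr ⟨b, rfl⟩)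
    simp [this]

/-- This form is the trace of left multiplication by v_b. -/
theorem sum_mem_formSpace_singleton (b : ℕ) :
    (fun v => ∑ i, ∑ x, A i (x, i) * v b x : (ℕ → Fin m → R) → R) ∈ formSpace A {b} := by
  let c : Unit × Fin 2 ≃ Unit ⊕ Unit := (Equiv.prodComm _ _).trans <|
    (Equiv.prodCongr (finTwoEquiv.trans Equiv.boolNot) (Equiv.refl _)).trans
      (Equiv.boolProdEquivSum _)
  convert wiring_mem_formSpace (A := A) c (fun _ => b) (Function.injective_of_subsingleton _)
    (s := {b}) (fun n => by simp [eq_comm]) using 1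
  funext v
  rw [wiring, ← Fintype.sum_prod_type']
  refine (Fintype.sum_equiv ((Equiv.sumArrowEquivProdArrow _ _ _).trans (Equiv.prodCongr
    (Equiv.funUnique Unit _) (Equiv.funUnique Unit _))) _ _ fun K => ?_).symm
  simp [c, Equiv.sumArrowEquivProdArrow, finTwoEquiv, Equiv.boolProdEquivSum]

end FormSpace

section FormSpace

variable {R : Type*} [CommRing R] {m : ℕ} {A : Matrix (Fin m) (Fin m × Fin m) R}

theorem one_mem_formSpace : (1 : (ℕ → Fin m → R) → R) ∈ formSpace A ∅ := by
  convert wiring_mem_formSpace (A := A) (β := Empty) (Equiv.equivOfIsEmpty _ _) Empty.elim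
    (fun a => a.elim) (s := ∅) (fun n => by simp) using 1
  funext v
  simp [wiring]

end FormSpace

/-! ### Power forms of the twisted algebra -/

section TwistedAlgebra

variable {L : Type*} [Field L] {m : ℕ}

/-- The form `v ↦ ∑ i, w i * ∏ b ∈ U, v b i`. -/
def powForm (w : Fin m → L) (U : Finset ℕ) (v : ℕ → Fin m → L) : L := ∑ i, w i * ∏ b ∈ U, v b i

theorem powForm_congr (w : Fin m → L) {U : Finset ℕ} {v v' : ℕ → Fin m → L}
    (h : ∀ b ∈ U, v b = v' b) : powForm w U v = powForm w U v' := by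
  refine Finset.sum_congr rfl fun i _ => ?_
  rw [Finset.prod_congr rfl fun b hb => by rw [h b hb]]

/-- The weights `d i = 1 - 1 / lam i`. -/
def twist (lam : Fin m → L) (i : Fin m) : L := 1 - (lam i)⁻¹

/-- The structure constants of the algebra `L^m` with the product
`(v w)_i = v_i (w_i + d_i ∑ j, lam_j w_j)`, where `d_i = 1 - 1 / lam_i`. -/
def twistedAlg (lam : Fin m → L) : Matrix (Fin m) (Fin m × Fin m) L :=
  Matrix.of fun i p => if p.1 = i then (if p.2 = i then 1 else 0) + twist lam i * lam p.2 else 0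

variable (lam : Fin m → L)

theorem algMul_twistedAlg (v w : Fin m → L) (i : Fin m) :
    algMul (twistedAlg lam) v w i = v i * (w i + twist lam i * ∑ j, lam j * w j) := by
  simp only [algMul, twistedAlg, Matrix.of_apply, ite_mul, zero_mul]
  rw [Finset.sum_comm]
  simp only [Finset.sum_ite_eq', Finset.mem_univ, if_true, add_mul, ite_mul, one_mul, zero_mul,
    Finset.sum_add_distrib, mul_add]
  congr 1
  rw [Finset.mul_sum, Finset.mul_sum]
  exact Finset.sum_congr rfl fun _ _ => by ring

/-- The product of the linear forms `lam` in the slots `s ∈ S`. -/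
def linProd (S : Finset ℕ) : (ℕ → Fin m → L) → L := ∏ s ∈ S, powForm lam {s}

theorem powForm_subst (w : Fin m → L) {U : Finset ℕ} {b n : ℕ} (hb : b ∈ U) (hn : n ∉ U)
    (v : ℕ → Fin m → L) :
    powForm w U (Function.update v b (algMul (twistedAlg lam) (v b) (v n))) =
      powForm w (insert n U) v + powForm (w * twist lam) U v * powForm lam {n} v := by
  simp only [powForm, Finset.prod_insert hn, Finset.prod_singleton, Finset.sum_mul]
  rw [← Finset.sum_add_distrib]
  refine Finset.sum_congr rfl fun i _ => ?_
  rw [← Finset.mul_prod_erase U _ hb, ← Finset.mul_prod_erase U _ hb, Function.update_self,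
    algMul_twistedAlg, Finset.prod_congr rfl fun c hc => by
      rw [Function.update_of_ne (Finset.ne_of_mem_erase hc)], Pi.mul_apply]
  ring

variable {lam}

/-- The twist is chosen so that 1 + d_i lam_i = lam_i: the linear form used to define the product is
the trace of left multiplication. -/
theorem powForm_lam_singleton_mem (hlam : ∀ i, lam i ≠ 0) (b : ℕ) :
    powForm lam {b} ∈ formSpace (twistedAlg lam) {b} := by
  convert sum_mem_formSpace_singleton (A := twistedAlg lam) b using 1
  funext v
  refine Finset.sum_congr rfl fun i _ => ?_
  simp only [twistedAlg, Matrix.of_apply, ite_mul, zero_mul, Finset.sum_ite_eq', Finset.mem_univ,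
    if_true, Finset.prod_singleton, twist]
  field_simp [hlam i]
  ring

theorem linProd_mem (hlam : ∀ i, lam i ≠ 0) (S : Finset ℕ) :
    linProd lam S ∈ formSpace (twistedAlg lam) S := by
  induction S using Finset.induction_on with
  | empty => exact one_mem_formSpace
  | insert n S hn ih =>
    rw [linProd, Finset.prod_insert hn, ← Finset.singleton_union]
    exact mul_mem_formSpace (Finset.disjoint_singleton_left.mpr hn)
      (powForm_lam_singleton_mem hlam n) ih

-- Right multiplication by w is diagonal with entries w_i + d_i lam(w). The form is the trace of a
-- composite of right multiplications, obtained by wiring the vertices of Z in one cycle.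
variable (lam) in
theorem trace_mem_formSpace (Z : Finset ℕ) (hZ : Z.Nonempty) :
    (fun v => ∑ i, ∏ b ∈ Z, (v b i + twist lam i * powForm lam {b} v) :
      (ℕ → Fin m → L) → L) ∈ formSpace (twistedAlg lam) Z := by
  obtain ⟨σ, hσ, -⟩ := Finset.exists_cycleOn (Finset.univ : Finset Z)
  let c : Z × Fin 2 ≃ Z ⊕ Z := (Equiv.prodComm _ _).trans <|
    (Equiv.prodCongr finTwoEquiv (Equiv.refl _)).trans <|
      (Equiv.boolProdEquivSum _).trans (Equiv.sumCongr σ (Equiv.refl _))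
  have c0 (a : Z) : c (a, 0) = Sum.inl (σ a) := by
    simp [c, finTwoEquiv, Equiv.boolProdEquivSum]
  have c1 (a : Z) : c (a, 1) = Sum.inr a := by
    simp [c, finTwoEquiv, Equiv.boolProdEquivSum]
  convert wiring_mem_formSpace (A := twistedAlg lam) c (fun b => (b : ℕ)) Subtype.val_injective
    (s := Z) (fun n => by simp) using 1
  funext v
  have hconst (I : Z → Fin m) (hI : ∀ a, I (σ a) = I a) (a b : Z) : I a = I b := by
    obtain ⟨n, hn⟩ := hσ.2 (Finset.mem_coe.mpr (Finset.mem_univ a))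
      (Finset.mem_coe.mpr (Finset.mem_univ b))
    have hz (n : ℤ) (a : Z) : I ((σ ^ n) a) = I a := by
      induction n using Int.induction_on generalizing a with
      | zero => simp
      | succ n ih => rw [zpow_add_one, Equiv.Perm.mul_apply, ih, hI]
      | pred n ih =>
        rw [zpow_sub_one, Equiv.Perm.mul_apply, ih, ← hI (σ⁻¹ a), ← Equiv.Perm.mul_apply,
          mul_inv_cancel, Equiv.Perm.one_apply]
    rw [← hn, hz]
  have hfac (I : Z → Fin m) : ∑ J : Z → Fin m,
      (∏ a, twistedAlg lam (I a) (I (σ a), J a)) * ∏ b : Z, v b (J b) =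
      ∏ a : Z, if I (σ a) = I a then v a (I a) + twist lam (I a) * powForm lam {(a : ℕ)} v
        else 0 := by
    simp_rw [← Finset.prod_mul_distrib]
    rw [← Fintype.prod_sum (fun (a : Z) (j : Fin m) => twistedAlg lam (I a) (I (σ a), j) * v a j)]
    refine Finset.prod_congr rfl fun a _ => ?_
    split_ifs with h
    · simp only [twistedAlg, Matrix.of_apply, h, if_true, add_mul, Finset.sum_add_distrib, ite_mul,
        one_mul, zero_mul, Finset.sum_ite_eq', Finset.mem_univ, powForm, Finset.prod_singleton,
        Finset.mul_sum, mul_assoc]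
    · simp [twistedAlg, h]
  unfold wiring
  rw [Fintype.sum_equiv (Equiv.sumArrowEquivProdArrow _ _ _) _ (fun x =>
    (∏ a, twistedAlg lam (x.1 a) (x.1 (σ a), x.2 a)) * ∏ b : Z, v b (x.2 b)) (fun K => by
      simp [c0, c1, Equiv.sumArrowEquivProdArrow]), Fintype.sum_prod_type]
  simp_rw [hfac]
  obtain ⟨z₀, hz₀⟩ := hZ
  symm
  -- Only labellings constant along the cycle contribute; as σ is transitive on Z, these are the
  -- constant ones.
  rw [← Finset.sum_subset (Finset.subset_univ
    (Finset.univ.image fun (i : Fin m) (_ : Z) => i))]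
  · rw [Finset.sum_image fun i _ j _ h => congrFun h ⟨z₀, hz₀⟩]
    refine Finset.sum_congr rfl fun i _ => ?_
    simp only [if_true]
    exact Finset.prod_coe_sort Z fun b => v b i + twist lam i * powForm lam {b} v
  · intro I _ hI
    by_contra hne
    refine hI (Finset.mem_image.mpr ⟨I ⟨z₀, hz₀⟩, Finset.mem_univ _, ?_⟩)
    funext a
    refine hconst I (fun a => ?_) _ _
    by_contra h
    exact hne (Finset.prod_eq_zero (Finset.mem_univ a) (if_neg h))

theorem powForm_mul_linProd_add_mem (w : Fin m → L) {U S : Finset ℕ} {b n : ℕ} (hb : b ∈ U)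
    (hUS : Disjoint U S) (hn : n ∉ U) (hn' : n ∉ S)
    (h : powForm w U * linProd lam S ∈ formSpace (twistedAlg lam) (U ∪ S)) :
    powForm w (insert n U) * linProd lam S + powForm (w * twist lam) U * linProd lam (insert n S) ∈
      formSpace (twistedAlg lam) (insert n (U ∪ S)) := by
  convert subst_mem_formSpace (Finset.mem_union_left S hb) (n := n)
    (by simp [hn, hn']) h using 1
  funext v
  simp only [Pi.add_apply, Pi.mul_apply, powForm_subst lam w hb hn]
  have h1 : linProd lam S (Function.update v b (algMul (twistedAlg lam) (v b) (v n))) =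
      linProd lam S v := by
    simp only [linProd, Finset.prod_apply]
    refine Finset.prod_congr rfl fun s hs => powForm_congr _ fun c hc => ?_
    rw [Finset.mem_singleton.mp hc]
    have hsb : s ≠ b := fun h => Finset.disjoint_left.mp hUS hb (h ▸ hs)
    exact Function.update_of_ne hsb _ _
  have h2 : linProd lam (insert n S) v = powForm lam {n} v * linProd lam S v := by
    rw [linProd, Finset.prod_insert hn', Pi.mul_apply, linProd]
  rw [h1, h2]
  ring

/-- Let a_S be the form in question. Substitution into the forms on smaller slot sets gives a_S +
a_{S ∪ n} ≡ 0 modulo the span, so a_S ≡ (-1)^|S| a_∅ for S ≠ Z. The trace of right multiplications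
expands as ∑_{S ⊆ Z} a_S, where a_Z is a multiple of a product of linear forms lam. The signs over S
≠ Z add up to ±1, so a_∅ lies in the span, in every characteristic. -/
theorem powForm_twist_mul_linProd_mem (hlam : ∀ i, lam i ≠ 0) (Z : Finset ℕ) :
    ∀ S ⊂ Z, powForm (twist lam ^ S.card) (Z \ S) * linProd lam S ∈
      formSpace (twistedAlg lam) Z := by
  induction Z using Finset.strongInduction with
  | H Z ih =>
  set a : Finset ℕ → (ℕ → Fin m → L) → L := fun S =>
    powForm (twist lam ^ S.card) (Z \ S) * linProd lam S with ha
  have step (n : ℕ) (S : Finset ℕ) (hn : n ∉ S) (hS : insert n S ⊂ Z) :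
      a S + a (insert n S) ∈ formSpace (twistedAlg lam) Z := by
    have hnZ : n ∈ Z := hS.1 (Finset.mem_insert_self n S)
    obtain ⟨b, hbZ, hb⟩ := Finset.exists_of_ssubset hS
    have hbn : b ≠ n := fun h => hb (h ▸ Finset.mem_insert_self n S)
    have hbS : b ∉ S := fun h => hb (Finset.mem_insert_of_mem h)
    have hsub : S ⊆ Z.erase n := fun x hx =>
      Finset.mem_erase.mpr ⟨fun h => hn (h ▸ hx), hS.1 (Finset.mem_insert_of_mem hx)⟩
    have hbU : b ∈ Z.erase n \ S := by simp [hbZ, hbn, hbS]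
    have h1 := ih (Z.erase n) (Finset.erase_ssubset hnZ) S
      ((Finset.ssubset_iff_of_subset hsub).mpr ⟨b, by simp [hbn, hbZ], hbS⟩)
    rw [← Finset.sdiff_union_of_subset hsub] at h1
    have h2 := powForm_mul_linProd_add_mem (n := n) _ (U := Z.erase n \ S) hbU
      Finset.sdiff_disjoint (by simp) hn (by rwa [Finset.sdiff_union_of_subset hsub] at h1 ⊢)
    rw [Finset.sdiff_union_of_subset hsub, Finset.insert_erase hnZ,
      show insert n (Z.erase n \ S) = Z \ S by
        rw [← Finset.insert_sdiff_of_notMem _ hn, Finset.insert_erase hnZ],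
      show Z.erase n \ S = Z \ insert n S by
        ext x; simp only [Finset.mem_sdiff, Finset.mem_erase, Finset.mem_insert]; tauto,
      ← pow_succ, ← Finset.card_insert_of_notMem hn] at h2
    exact h2
  have alt (S : Finset ℕ) (hS : S ⊂ Z) :
      a S - (-1 : L) ^ S.card • a ∅ ∈ formSpace (twistedAlg lam) Z := by
    induction S using Finset.induction_on with
    | empty => simp
    | insert n S hn ihS =>
      have h3 := sub_mem (step n S hn hS)
        (ihS ⟨(Finset.subset_insert n S).trans hS.1, fun h => hS.2 (h.trans
          (Finset.subset_insert n S))⟩)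
      convert h3 using 1
      rw [Finset.card_insert_of_notMem hn, pow_succ, mul_neg_one, neg_smul]
      abel
  intro S hS
  have hZ : Z.Nonempty := Finset.nonempty_of_ne_empty fun h => by simp [h] at hS
  have hP : a ∅ ∈ formSpace (twistedAlg lam) Z := by
    have htr := trace_mem_formSpace lam Z hZ
    have htr' : (fun v => ∑ i, ∏ b ∈ Z, (v b i + twist lam i * powForm lam {b} v) :
        (ℕ → Fin m → L) → L) = ∑ S ∈ Z.powerset, a S := by
      funext v
      rw [Finset.sum_apply]
      simp_rw [add_comm (_ : L) (twist lam _ * _), Finset.prod_add, Finset.prod_mul_distrib,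
        Finset.prod_const]
      rw [Finset.sum_comm]
      refine Finset.sum_congr rfl fun S _ => ?_
      simp only [ha, Pi.mul_apply, powForm, linProd, Finset.prod_apply, Finset.sum_mul,
        Pi.pow_apply]
      exact Finset.sum_congr rfl fun i _ => by ring
    rw [htr', ← Finset.insert_erase (Finset.mem_powerset_self Z), Finset.sum_insert
      (Finset.notMem_erase _ _)] at htr
    have haZ : a Z ∈ formSpace (twistedAlg lam) Z := by
      have : a Z = (∑ i, twist lam i ^ Z.card) • linProd lam Z := by
        funext v
        simp [ha, powForm]
      rw [this]
      exact Submodule.smul_mem _ _ (linProd_mem hlam Z)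
    have h4 := (Submodule.add_mem_iff_right _ haZ).mp htr
    have h5 : ∑ S ∈ Z.powerset.erase Z, (a S - (-1 : L) ^ S.card • a ∅) ∈
        formSpace (twistedAlg lam) Z := sum_mem fun S hS => alt S (by
          rw [Finset.mem_erase, Finset.mem_powerset] at hS
          exact hS.2.ssubset_of_ne hS.1)
    rw [Finset.sum_sub_distrib, ← Finset.sum_smul] at h5
    have h6 := (Submodule.sub_mem_iff_right _ h4).mp h5
    have h7 : ∑ S ∈ Z.powerset.erase Z, (-1 : L) ^ S.card = -(-1) ^ Z.card := by
      have h8 := congrArg (Int.cast (R := L)) (Finset.sum_powerset_neg_one_pow_card_of_nonempty hZ)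
      push_cast at h8
      rw [← Finset.add_sum_erase _ _ (Finset.mem_powerset_self Z)] at h8
      exact eq_neg_of_add_eq_zero_right h8
    rw [h7] at h6
    exact (Submodule.smul_mem_iff _ (neg_ne_zero.mpr (pow_ne_zero _ (by simp)))).mp h6
  exact (Submodule.sub_mem_iff_left _ (Submodule.smul_mem _ _ hP)).mp (alt S hS)

end TwistedAlgebra

/-! ### Trading power-form factors for coordinates -/

section TwistedAlgebra

variable {L : Type*} [Field L] {m : ℕ} {lam : Fin m → L}

theorem powForm_one_mem (hlam : ∀ i, lam i ≠ 0) {S : Finset ℕ} (hS : S.Nonempty) :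
    powForm 1 S ∈ formSpace (twistedAlg lam) S := by
  have := powForm_twist_mul_linProd_mem hlam S ∅ (Finset.empty_ssubset.mpr hS)
  simpa [linProd] using this

/-- X need not lie in the span. Since lam · d = lam - 1, substituting v_b v_n into X p_lam(S) yields
X p_lam(S ∪ n) plus X p_lam(S) lam(v_n) minus X lam(v_n) p_1(S), and the last two forms are already
available. -/
theorem mul_powForm_lam_mem (hlam : ∀ i, lam i ≠ 0) {X : (ℕ → Fin m → L) → L} {Y : Finset ℕ}
    (hXY : ∀ v v', (∀ b ∈ Y, v b = v' b) → X v = X v')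
    (hX : ∀ n ∉ Y, X * powForm lam {n} ∈ formSpace (twistedAlg lam) (insert n Y))
    {S : Finset ℕ} (hS : S.Nonempty) (hYS : Disjoint Y S) :
    X * powForm lam S ∈ formSpace (twistedAlg lam) (Y ∪ S) := by
  induction hS using Finset.Nonempty.cons_induction with
  | singleton n =>
    rw [Finset.union_comm, Finset.singleton_union]
    exact hX n (Finset.disjoint_singleton_right.mp hYS)
  | cons n S hn hS ih =>
    rw [Finset.cons_eq_insert] at hYS ⊢
    rw [Finset.disjoint_insert_right] at hYS
    obtain ⟨b, hb⟩ := hS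
    have h1 := subst_mem_formSpace (Finset.mem_union_right Y hb) (n := n)
      (by simp [hn, hYS.1]) (ih hYS.2)
    have h2 := mul_mem_formSpace (by simp [hn, hYS.1]) (ih hYS.2)
      (powForm_lam_singleton_mem hlam n)
    have h3 := mul_mem_formSpace (by simp [hn, hYS.2]) (hX n hYS.1)
      (powForm_one_mem hlam ⟨b, hb⟩)
    have e2 : Y ∪ S ∪ {n} = Y ∪ insert n S := by ext; simp
    have e3 : insert n Y ∪ S = Y ∪ insert n S := by ext; simp
    have e1 : insert n (Y ∪ S) = Y ∪ insert n S := by ext; simp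
    rw [e1] at h1
    rw [e2] at h2
    rw [e3] at h3
    convert add_mem (sub_mem h1 h2) h3 using 1
    funext v
    have hw : powForm (lam * twist lam) S v = powForm lam S v - powForm 1 S v := by
      simp only [powForm, ← Finset.sum_sub_distrib]
      refine Finset.sum_congr rfl fun i _ => ?_
      have : (lam * twist lam) i = lam i - 1 := by
        simp [twist, mul_sub, hlam i]
      rw [this, Pi.one_apply]
      ring
    have hXv : X (Function.update v b (algMul (twistedAlg lam) (v b) (v n))) = X v :=
      hXY _ _ fun c hc => by
        have hcb : c ≠ b := fun h => Finset.disjoint_left.mp hYS.2 hc (h ▸ hb)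
        rw [Function.update_of_ne hcb]
    simp only [Pi.mul_apply, Pi.add_apply, Pi.sub_apply, powForm_subst lam lam hb hn, hw, hXv]
    ring

/-- `PowProd lam M t f` says that `f` is a product of `M` forms `powForm lam S` with disjoint
nonempty `S` and that `t` is the union of these sets. -/
inductive PowProd (lam : Fin m → L) : ℕ → Finset ℕ → ((ℕ → Fin m → L) → L) → Prop
  | nil : PowProd lam 0 ∅ 1
  | cons {M : ℕ} {S t : Finset ℕ} {f : (ℕ → Fin m → L) → L} (hS : S.Nonempty) (hSt : Disjoint S t)
      (h : PowProd lam M t f) : PowProd lam (M + 1) (S ∪ t) (powForm lam S * f)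

theorem PowProd.mem_formSpace (hlam : ∀ i, lam i ≠ 0) {M : ℕ} {t : Finset ℕ}
    {f : (ℕ → Fin m → L) → L} (h : PowProd lam M t f) : f ∈ formSpace (twistedAlg lam) t := by
  induction h with
  | nil => exact one_mem_formSpace
  | @cons M S t f hS hSt _ ih =>
    refine mul_mem_formSpace hSt ?_ ih
    have := mul_powForm_lam_mem hlam (X := 1) (Y := ∅) (fun _ _ _ => rfl)
      (fun n _ => by
        rw [one_mul, insert_empty_eq]
        exact powForm_lam_singleton_mem hlam n) hS (Finset.disjoint_empty_left _)
    simpa using this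

theorem PowProd.split {M N : ℕ} {t : Finset ℕ} {f : (ℕ → Fin m → L) → L}
    (h : PowProd lam (M + N) t f) : ∃ t₁ t₂ f₁ f₂, PowProd lam M t₁ f₁ ∧ PowProd lam N t₂ f₂ ∧
      Disjoint t₁ t₂ ∧ t = t₁ ∪ t₂ ∧ f = f₁ * f₂ := by
  induction M generalizing t f with
  | zero => exact ⟨∅, t, 1, f, .nil, by simpa using h, by simp, by simp, by simp⟩
  | succ M ih =>
    rw [Nat.add_right_comm] at h
    cases h with
    | @cons _ S t f hS hSt h =>
      obtain ⟨t₁, t₂, f₁, f₂, h₁, h₂, hd, rfl, rfl⟩ := ih h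
      rw [Finset.disjoint_union_right] at hSt
      exact ⟨S ∪ t₁, t₂, _, f₂, .cons hS hSt.1 h₁, h₂, Finset.disjoint_union_left.mpr ⟨hSt.2, hd⟩,
        (Finset.union_assoc _ _ _).symm, (mul_assoc _ _ _).symm⟩

/-- The case without f comes from the alternating-sum argument. The linear factors in the slots of S
are then enlarged one at a time to factors p_lam(S₀), so S serves as a reservoir in the induction.
-/
theorem powForm_twist_mul_powProd_mem (hlam : ∀ i, lam i ≠ 0) {c : ℕ} {t : Finset ℕ}
    {f : (ℕ → Fin m → L) → L} (h : PowProd lam c t f) {b : ℕ} (hbt : b ∉ t) (S : Finset ℕ)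
    (hbS : b ∉ S) (hSt : Disjoint S t) :
    powForm (twist lam ^ (c + S.card)) {b} * linProd lam S * f ∈
      formSpace (twistedAlg lam) (insert b (S ∪ t)) := by
  induction h generalizing S with
  | nil =>
    have := powForm_twist_mul_linProd_mem hlam (insert b S) S (Finset.ssubset_insert hbS)
    rw [Finset.insert_sdiff_of_notMem _ hbS, Finset.sdiff_self, insert_empty_eq] at this
    simpa using this
  | @cons M S₀ t f hS₀ hSt₀ h ih =>
    rw [Finset.mem_union, not_or] at hbt
    rw [Finset.disjoint_union_right] at hSt
    have key := mul_powForm_lam_mem hlam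
      (X := powForm (twist lam ^ (M + 1 + S.card)) {b} * linProd lam S * f)
      (Y := insert b (S ∪ t)) (fun v v' hv => ?_) (fun n hn => ?_) hS₀ ?_
    · rw [mul_comm (powForm lam S₀), ← mul_assoc, Finset.union_comm S₀, ← Finset.union_assoc,
        ← Finset.insert_union]
      exact key
    · simp only [Pi.mul_apply]
      rw [powForm_congr _ fun c hc => hv c (by simp at hc; simp [hc]),
        congr_of_mem_formSpace (linProd_mem hlam S) fun c hc => hv c (by simp [hc]),
        congr_of_mem_formSpace (h.mem_formSpace hlam) fun c hc => hv c (by simp [hc])]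
    · rw [Finset.mem_insert, Finset.mem_union, not_or, not_or] at hn
      have := ih hbt.2 (insert n S) (by simp [Ne.symm hn.1, hbS]) (by simp [hn.2.2, hSt.2])
      have hlin : linProd lam (insert n S) = powForm lam {n} * linProd lam S :=
        Finset.prod_insert hn.2.1
      rw [hlin, Finset.card_insert_of_notMem hn.2.1, Finset.insert_union, Finset.insert_comm,
        ← add_assoc, add_right_comm] at this
      convert this using 1
      ring
    · rw [Finset.disjoint_insert_left, Finset.disjoint_union_left]
      exact ⟨hbt.1, hSt.1, hSt₀.symm⟩

/-- A power sum with weights d^c consumes c of the m factors of f. The d_i are distinct, so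
interpolation recovers a single coordinate from the power sums with c ≤ m. -/
theorem eval_mul_powProd_mem (hlam : ∀ i, lam i ≠ 0) (hinj : Function.Injective lam)
    {t : Finset ℕ} {f : (ℕ → Fin m → L) → L} (h : PowProd lam m t f) {b : ℕ} (hbt : b ∉ t)
    (i : Fin m) :
    (fun v => v b i) * f ∈ formSpace (twistedAlg lam) (insert b t) := by
  have htw : Function.Injective (twist lam) := fun i j hij => by
    simpa [twist, hinj.eq_iff] using hij
  have hc (c : ℕ) (hcm : c ≤ m) :
      powForm (twist lam ^ c) {b} * f ∈ formSpace (twistedAlg lam) (insert b t) := by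
    obtain ⟨e, rfl⟩ := Nat.exists_eq_add_of_le hcm
    obtain ⟨t₁, t₂, f₁, f₂, h₁, h₂, hd, rfl, rfl⟩ := h.split
    rw [Finset.mem_union, not_or] at hbt
    have := powForm_twist_mul_powProd_mem hlam h₁ hbt.1 ∅ (by simp) (by simp)
    rw [linProd, Finset.prod_empty, mul_one, Finset.card_empty, add_zero,
      Finset.empty_union] at this
    rw [← mul_assoc, ← Finset.insert_union]
    exact mul_mem_formSpace (Finset.disjoint_insert_left.mpr ⟨hbt.2, hd⟩) this
      (h₂.mem_formSpace hlam)
  let p : Polynomial L := Lagrange.basis Finset.univ (twist lam) i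
  have hdeg : p.natDegree < m + 1 := by
    have := Lagrange.degree_basis (s := Finset.univ) (htw.injOn) (Finset.mem_univ i)
    rw [Finset.card_univ, Fintype.card_fin] at this
    exact Nat.lt_succ_of_le ((Polynomial.natDegree_le_of_degree_le this.le).trans (Nat.sub_le _ _))
  have hp : (fun v => v b i : (ℕ → Fin m → L) → L) =
      ∑ c ∈ Finset.range (m + 1), p.coeff c • powForm (twist lam ^ c) {b} := by
    funext v
    rw [Finset.sum_apply]
    simp only [Pi.smul_apply, powForm, smul_eq_mul, Finset.mul_sum, Finset.prod_singleton,
      Pi.pow_apply, ← mul_assoc]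
    rw [Finset.sum_comm]
    simp_rw [← Finset.sum_mul, ← Polynomial.eval_eq_sum_range' hdeg]
    rw [Finset.sum_eq_single i]
    · rw [Lagrange.eval_basis_self htw.injOn (Finset.mem_univ i), one_mul]
    · intro j _ hj
      rw [Lagrange.eval_basis_of_ne hj.symm (Finset.mem_univ j), zero_mul]
    · simp
  rw [hp, Finset.sum_mul]
  refine sum_mem fun c hcm => ?_
  rw [smul_mul_assoc]
  exact Submodule.smul_mem _ _ (hc c (Nat.lt_succ_iff.mp (Finset.mem_range.mp hcm)))

/-- The form `v ↦ ∏ b ∈ u, v b (x b)`. -/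
def wordForm (x : ℕ → Fin m) (u : Finset ℕ) (v : ℕ → Fin m → L) : L := ∏ b ∈ u, v b (x b)

theorem wordForm_mul_powProd_mem (hlam : ∀ i, lam i ≠ 0) (hinj : Function.Injective lam)
    (x : ℕ → Fin m) {u t : Finset ℕ} {M : ℕ} {f : (ℕ → Fin m → L) → L} (hM : u.card * m ≤ M)
    (h : PowProd lam M t f) (hut : Disjoint u t) :
    wordForm x u * f ∈ formSpace (twistedAlg lam) (u ∪ t) := by
  induction u using Finset.induction_on generalizing M t f with
  | empty =>
    have : wordForm x ∅ = (1 : (ℕ → Fin m → L) → L) := by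
      funext v
      simp [wordForm]
    rw [this, one_mul, Finset.empty_union]
    exact h.mem_formSpace hlam
  | insert b u hb ih =>
    rw [Finset.card_insert_of_notMem hb, add_mul, one_mul, add_comm] at hM
    obtain ⟨e, rfl⟩ := Nat.exists_eq_add_of_le ((Nat.le_add_right _ _).trans hM)
    obtain ⟨t₁, t₂, f₁, f₂, h₁, h₂, hd, rfl, rfl⟩ := h.split
    rw [Finset.disjoint_insert_left, Finset.mem_union, not_or, Finset.disjoint_union_right] at hut
    have h3 := mul_mem_formSpace ?_ (eval_mul_powProd_mem hlam hinj h₁ hut.1.1 (x b))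
      (ih (by omega) h₂ hut.2.2)
    · have e1 : wordForm x (insert b u) = (fun v => v b (x b)) * (wordForm x u :
          (ℕ → Fin m → L) → L) := by
        funext v
        simp [wordForm, Finset.prod_insert hb]
      have e2 : insert b u ∪ (t₁ ∪ t₂) = insert b t₁ ∪ (u ∪ t₂) := by ext; simp; tauto
      rw [e1, e2, mul_mul_mul_comm]
      exact h3
    · rw [Finset.disjoint_insert_left, Finset.mem_union, not_or, Finset.disjoint_union_right]
      exact ⟨⟨hb, hut.1.2⟩, hut.2.1.symm, hd⟩

/-- If words on sets of `k₁` slots lie in the ideal generated by the forms `powForm lam S`, then all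
sufficiently long words come from contractions. -/
theorem wordForm_mem_formSpace (hlam : ∀ i, lam i ≠ 0) (hinj : Function.Injective lam) {k₁ : ℕ}
    (hk₁ : ∀ (u : Finset ℕ) (x : ℕ → Fin m), u.card = k₁ → (wordForm x u : (ℕ → Fin m → L) → L) ∈
      Submodule.span L {φ | ∃ S ⊆ u, S.Nonempty ∧ ∃ y, φ = powForm lam S * wordForm y (u \ S)})
    (x : ℕ → Fin m) (s : Finset ℕ) (hs : k₁ + k₁ * (k₁ * m) ≤ s.card) :
    wordForm x s ∈ formSpace (twistedAlg lam) s := by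
  -- Each rewriting of k₁ letters removes the letters in some nonempty S with |S| ≤ k₁ and adds one
  -- factor, so |u| drops while |u| + k₁M does not decrease.
  have main (r : ℕ) : ∀ (u t : Finset ℕ) (M : ℕ) (f : (ℕ → Fin m → L) → L) (x : ℕ → Fin m),
      u.card = r → PowProd lam M t f → Disjoint u t →
      k₁ + k₁ * (k₁ * m) ≤ u.card + k₁ * M →
      wordForm x u * f ∈ formSpace (twistedAlg lam) (u ∪ t) := by
    induction r using Nat.strong_induction_on with
    | _ r ih =>
    intro u t M f x hur hf hut hle
    rcases lt_or_ge u.card k₁ with hlt | hge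
    -- With fewer than k₁ letters left, the bound forces M ≥ k₁m, enough to pay m factors for each
    -- remaining letter.
    · refine wordForm_mul_powProd_mem hlam hinj x ?_ hf hut
      have : k₁ * (k₁ * m) ≤ k₁ * M := by omega
      have h2 := Nat.le_of_mul_le_mul_left this (by omega)
      exact (Nat.mul_le_mul_right m hlt.le).trans h2
    · obtain ⟨u', hu', hcard⟩ := Finset.exists_subset_card_eq hge
      have hword (z : ℕ → Fin m) (w : Finset ℕ) (w' : Finset ℕ) (hw : Disjoint w w') :
          (wordForm z (w ∪ w') : (ℕ → Fin m → L) → L) = wordForm z w * wordForm z w' := by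
        funext v
        simp [wordForm, Finset.prod_union hw]
      have hsplit : (wordForm x u : (ℕ → Fin m → L) → L) =
          wordForm x u' * wordForm x (u \ u') := by
        rw [← hword _ _ _ Finset.disjoint_sdiff, Finset.union_sdiff_of_subset hu']
      rw [hsplit]
      have hmem := hk₁ u' x hcard
      generalize (wordForm x u' : (ℕ → Fin m → L) → L) = g at hmem
      induction hmem using Submodule.span_induction with
      | zero => rw [zero_mul, zero_mul]; exact zero_mem _
      | add g h _ _ hg hh => rw [add_mul, add_mul]; exact add_mem hg hh
      | smul a g _ hg =>
        rw [smul_mul_assoc, smul_mul_assoc]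
        exact Submodule.smul_mem _ _ hg
      | mem g hg =>
        obtain ⟨S, hSu', hS, y, rfl⟩ := hg
        have hSu := hSu'.trans hu'
        have hcS : S.card ≤ k₁ := hcard ▸ Finset.card_le_card hSu'
        have hc : (u \ S).card + S.card = u.card := Finset.card_sdiff_add_card_eq_card hSu
        have hSpos := hS.card_pos
        have hdisj := Finset.disjoint_of_subset_left hSu hut
        have h4 := ih (u \ S).card (by omega) (u \ S) (S ∪ t) (M + 1) (powForm lam S * f)
          (fun b => if b ∈ u' then y b else x b) rfl (.cons hS hdisj hf)
          (Finset.disjoint_union_right.mpr ⟨Finset.sdiff_disjoint,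
            Finset.disjoint_of_subset_left Finset.sdiff_subset hut⟩) (by
            rw [mul_add, mul_one]; omega)
        have e1 : u \ S = (u' \ S) ∪ (u \ u') := by
          ext b
          have := @hu' b
          have := @hSu' b
          simp only [Finset.mem_sdiff, Finset.mem_union]
          tauto
        have e2 : (u \ S) ∪ (S ∪ t) = u ∪ t := by
          rw [← Finset.union_assoc, Finset.sdiff_union_of_subset hSu]
        have e3 : (wordForm (fun b => if b ∈ u' then y b else x b) (u' \ S) :
            (ℕ → Fin m → L) → L) = wordForm y (u' \ S) := by
          funext v
          refine Finset.prod_congr rfl fun b hb => ?_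
          simp only [if_pos (Finset.sdiff_subset hb)]
        have e4 : (wordForm (fun b => if b ∈ u' then y b else x b) (u \ u') :
            (ℕ → Fin m → L) → L) = wordForm x (u \ u') := by
          funext v
          refine Finset.prod_congr rfl fun b hb => ?_
          simp only [if_neg (Finset.mem_sdiff.mp hb).2]
        rw [e2, e1, hword _ _ _ (Finset.disjoint_of_subset_left Finset.sdiff_subset
          Finset.disjoint_sdiff), e3, e4] at h4
        convert h4 using 1
        ring
  have := main s.card s ∅ 0 1 x rfl .nil (Finset.disjoint_empty_right _) (by omega)
  simpa using this

end TwistedAlgebra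

/-! ### The ideal generated by the power forms -/

section Ideal

variable {L : Type*} [Field L] {m : ℕ}

/-- The forms on the slots in `u` that lie in the ideal generated by the forms `powForm lam S`. -/
def powIdeal (lam : Fin m → L) (u : Finset ℕ) : Submodule L ((ℕ → Fin m → L) → L) :=
  Submodule.span L {φ | ∃ S ⊆ u, S.Nonempty ∧ ∃ y, φ = powForm lam S * wordForm y (u \ S)}

/-- Expanding the differences, each choice of v_{p i}(l) enlarges S by p i, while each choice of
v_{p i}(i) only adds a letter to the word. The point of the form is that its terms with l ∈ I
vanish. -/
theorem sum_mul_prod_sub_mem_powIdeal (lam : Fin m → L) {u : Finset ℕ} (p : Fin m → ℕ)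
    (hp : Function.Injective p) (I : Finset (Fin m)) (hI : ∀ i ∈ I, p i ∈ u) (S : Finset ℕ)
    (hS : S.Nonempty) (hSu : S ⊆ u) (hSI : ∀ i ∈ I, p i ∉ S) (y : ℕ → Fin m) :
    (fun v => (∑ l, lam l * (∏ b ∈ S, v b l) * ∏ i ∈ I, (v (p i) l - v (p i) i)) *
      wordForm y (u \ (S ∪ I.image p)) v) ∈ powIdeal lam u := by
  induction I using Finset.induction_on generalizing S y with
  | empty =>
    refine Submodule.subset_span ⟨S, hSu, hS, y, ?_⟩
    funext v
    simp [powForm]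
  | insert i I hi ih =>
    have hpi : p i ∉ S := hSI i (Finset.mem_insert_self i I)
    have hpu : p i ∈ u := hI i (Finset.mem_insert_self i I)
    have hpI : p i ∉ I.image p := by
      simpa [hp.eq_iff] using hi
    have h1 := ih (fun j hj => hI j (Finset.mem_insert_of_mem hj)) (insert (p i) S)
      (Finset.insert_nonempty _ _) (Finset.insert_subset hpu hSu) (fun j hj h => by
        rcases Finset.mem_insert.mp h with h | h
        · exact hi (hp h ▸ hj)
        · exact hSI j (Finset.mem_insert_of_mem hj) h) y
    have h2 := ih (fun j hj => hI j (Finset.mem_insert_of_mem hj)) S hS hSu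
      (fun j hj => hSI j (Finset.mem_insert_of_mem hj)) (Function.update y (p i) i)
    have e1 : u \ (insert (p i) S ∪ I.image p) = u \ (S ∪ (insert i I).image p) := by
      ext; simp
    have e2 : u \ (S ∪ I.image p) = insert (p i) (u \ (S ∪ (insert i I).image p)) := by
      ext b
      by_cases hb : b = p i
      · subst hb
        simp only [Finset.mem_sdiff, hpu, Finset.mem_union, hpi, hpI, Finset.mem_insert]
        simp
      · simp [hb]
    have hnot : p i ∉ u \ (S ∪ (insert i I).image p) := by simp
    rw [e1] at h1
    rw [e2] at h2
    convert sub_mem h1 h2 using 1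
    funext v
    have h3 : wordForm (Function.update y (p i) i) (insert (p i) (u \ (S ∪ (insert i I).image p))) v
        = v (p i) i * wordForm y (u \ (S ∪ (insert i I).image p)) v := by
      simp only [wordForm, Finset.prod_insert hnot, Function.update_self]
      congr 1
      refine Finset.prod_congr rfl fun b hb => ?_
      have hne : b ≠ p i := fun h => hnot (h ▸ hb)
      rw [Function.update_of_ne hne]
    simp only [Pi.sub_apply, h3, Finset.prod_insert hi, Finset.prod_insert hpi]
    rw [← mul_assoc, ← sub_mul]
    congr 1
    rw [Finset.sum_mul, ← Finset.sum_sub_distrib]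
    exact Finset.sum_congr rfl fun l _ => by ring

/-- The extension of a word on `u` by the word `x`. -/
def extendWord {u : Finset ℕ} (x : ℕ → Fin m) (J : u → Fin m) (b : ℕ) : Fin m :=
  if h : b ∈ u then J ⟨b, h⟩ else x b

theorem extendWord_coe {u : Finset ℕ} (x : ℕ → Fin m) (J : u → Fin m) (b : u) :
    extendWord x J b = J b := by
  simp [extendWord]

theorem wordForm_single (J y : ℕ → Fin m) (U : Finset ℕ) :
    wordForm y U (fun b => (Pi.single (J b) 1 : Fin m → L)) =
      if ∀ b ∈ U, J b = y b then 1 else 0 := by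
  rw [wordForm]
  split_ifs with h
  · exact Finset.prod_eq_one fun b hb => by rw [h b hb, Pi.single_eq_same]
  · push Not at h
    obtain ⟨b, hb, hne⟩ := h
    exact Finset.prod_eq_zero hb (Pi.single_eq_of_ne hne.symm 1)

/-- Elements of `powIdeal lam u` are determined by their values on basis vectors. -/
theorem eq_sum_wordForm_of_mem_powIdeal {lam : Fin m → L} {u : Finset ℕ} (x : ℕ → Fin m)
    {φ : (ℕ → Fin m → L) → L} (hφ : φ ∈ powIdeal lam u) :
    φ = ∑ J : u → Fin m, φ (fun b => Pi.single (extendWord x J b) 1) •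
      wordForm (extendWord x J) u := by
  have hword (y : ℕ → Fin m) : (wordForm y u : (ℕ → Fin m → L) → L) = ∑ J : u → Fin m,
      wordForm y u (fun b => (Pi.single (extendWord x J b) 1 : Fin m → L)) •
        wordForm (extendWord x J) u := by
    rw [Finset.sum_eq_single fun b : u => y b]
    · rw [wordForm_single, if_pos fun b hb => by simp [extendWord, hb], one_smul]
      funext v
      exact Finset.prod_congr rfl fun b hb => by simp [extendWord, hb]
    · intro J _ hJ
      obtain ⟨b, hb⟩ := Function.ne_iff.mp hJ
      rw [wordForm_single, if_neg fun h => hb (by rw [← h b b.2, extendWord_coe]), zero_smul]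
    · simp
  induction hφ using Submodule.span_induction with
  | zero => simp
  | add f g _ _ hf hg =>
    conv_lhs => rw [hf, hg]
    simp only [Pi.add_apply, add_smul, Finset.sum_add_distrib]
  | smul a f _ hf =>
    conv_lhs => rw [hf]
    simp only [Pi.smul_apply, smul_assoc, Finset.smul_sum]
  | mem f hf =>
    obtain ⟨S, hSu, -, y, rfl⟩ := hf
    have : powForm lam S * wordForm y (u \ S) =
        ∑ l, lam l • wordForm (fun b => if b ∈ S then l else y b) u := by
      funext v
      rw [Pi.mul_apply, powForm, Finset.sum_apply, Finset.sum_mul]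
      refine Finset.sum_congr rfl fun l _ => ?_
      simp only [Pi.smul_apply, smul_eq_mul, wordForm]
      rw [← Finset.prod_sdiff hSu, mul_assoc, mul_comm (∏ b ∈ S, _)]
      congr 2
      · exact Finset.prod_congr rfl fun b hb => by rw [if_neg (Finset.mem_sdiff.mp hb).2]
      · exact Finset.prod_congr rfl fun b hb => by rw [if_pos hb]
    rw [this]
    conv_lhs => rw [Finset.sum_congr rfl fun l _ => by
      rw [hword fun b => if b ∈ S then l else y b]]
    simp only [Finset.sum_apply, Pi.smul_apply, Finset.sum_smul, Finset.smul_sum, smul_assoc]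
    rw [Finset.sum_comm]

end Ideal

/-! ### Degeneration at t = 0 -/

section Degeneration

variable {F : Type*} [Field F] {m : ℕ}

/-- A word with more than `m * m` letters contains some letter at more than `m` places. -/
theorem exists_embedding_letter {u : Finset ℕ} (hu : m * m < u.card) (y : u → Fin m) :
    ∃ (j : Fin m) (q : Option (Fin m) ↪ u), ∀ o, y (q o) = j := by
  obtain ⟨j, hj⟩ := Fintype.exists_lt_card_fiber_of_mul_lt_card y (n := m) (by simpa using hu)
  have hcard : Fintype.card (Option (Fin m)) ≤ Fintype.card {b // y b = j} := by
    rw [Fintype.card_option, Fintype.card_fin, Fintype.card_subtype]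
    exact hj
  obtain ⟨q⟩ := Function.Embedding.nonempty_of_card_le hcard
  exact ⟨j, q.trans (Function.Embedding.subtype _), fun o => (q o).2⟩

/-- The coefficients, with respect to words, of the elements of `powIdeal` for the weights `X ^ l`
which are small deformations of the word `y`. -/
noncomputable def degenerationMatrix (u : Finset ℕ) (j : (u → Fin m) → Fin m)
    (q : (u → Fin m) → Option (Fin m) ↪ u) :
    Matrix (u → Fin m) (u → Fin m) (Polynomial F) :=
  Matrix.of fun y J => if (∀ b, b ≠ q y none → (∀ i < j y, b ≠ q y (some i)) → J b = y b) ∧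
      j y ≤ J (q y none) then
    Polynomial.X ^ ((J (q y none) : ℕ) - j y) * ∏ i ∈ Finset.Iio (j y),
      ((if J (q y (some i)) = J (q y none) then 1 else 0) - if J (q y (some i)) = i then 1 else 0)
  else 0

/-- At t = 0 the matrix is unitriangular for the pointwise order on words: row y keeps the word y,
and otherwise only words in which some occurrences of j are replaced by smaller letters. -/
theorem det_degenerationMatrix_ne_zero (u : Finset ℕ) (j : (u → Fin m) → Fin m)
    (q : (u → Fin m) → Option (Fin m) ↪ u) (hq : ∀ y o, y (q y o) = j y) :
    (degenerationMatrix (F := F) u j q).det ≠ 0 := by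
  set M := degenerationMatrix (F := F) u j q
  let ε : Polynomial F →+* F := Polynomial.evalRingHom 0
  have hdiag (y : u → Fin m) : ε (M y y) = 1 := by
    simp only [M, degenerationMatrix, Matrix.of_apply]
    rw [if_pos ⟨fun _ _ _ => trivial, (hq y none).ge⟩]
    simp only [hq y, Nat.sub_self, pow_zero, one_mul, if_true]
    rw [map_prod]
    refine Finset.prod_eq_one fun i hi => ?_
    rw [if_neg (Finset.mem_Iio.mp hi).ne', sub_zero, map_one]
  have hle (y J : u → Fin m) (h : ε (M y J) ≠ 0) : J ≤ y := by
    simp only [M, degenerationMatrix, Matrix.of_apply] at h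
    split_ifs at h with hif
    · rw [map_mul, map_pow, map_prod] at h
      have hX : ε Polynomial.X = 0 := by simp [ε]
      have h0 : J (q y none) = j y := by
        refine le_antisymm ?_ hif.2
        by_contra hlt
        rw [not_le, Fin.lt_def] at hlt
        rw [hX, zero_pow (by omega), zero_mul] at h
        exact h rfl
      intro b
      by_cases hb : b = q y none
      · rw [hb, h0, hq y]
      by_cases hb' : ∃ i < j y, b = q y (some i)
      · obtain ⟨i, hi, rfl⟩ := hb'
        have h1 := Finset.prod_ne_zero_iff.mp (right_ne_zero_of_mul h) i (Finset.mem_Iio.mpr hi)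
        rw [hq y]
        by_cases hJ1 : J (q y (some i)) = J (q y none)
        · rw [hJ1, h0]
        · by_cases hJ2 : J (q y (some i)) = i
          · rw [hJ2]
            exact hi.le
          · rw [if_neg hJ1, if_neg hJ2, sub_zero, map_zero] at h1
            exact absurd rfl h1
      · push Not at hb'
        exact (hif.1 b hb hb').le
    · rw [map_zero] at h
      exact absurd rfl h
  intro hdet
  have hdet0 : (M.map ε).det = 0 := by
    rw [← RingHom.mapMatrix_apply, ← RingHom.map_det, hdet, map_zero]
  obtain ⟨θ, hθ, hMθ⟩ := Matrix.exists_mulVec_eq_zero_iff.mpr hdet0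
  refine hθ (funext fun y => ?_)
  induction y using WellFoundedLT.induction with
  | ind y ih =>
    have h1 := congrFun hMθ y
    rw [Matrix.mulVec, dotProduct, Finset.sum_eq_single y] at h1
    · simpa [hdiag] using h1
    · intro J _ hJ
      by_cases h : ε (M y J) = 0
      · simp [h]
      · rw [ih J (lt_of_le_of_ne (hle y J h) hJ)]
        simp
    · simp

/-- A letter j of y at more than m places leaves room for one base slot and one slot for each i < j.
The ideal element with differences at these slots has no terms l < j, hence is divisible by t^j; the
quotients are the rows of an invertible matrix, so they span all words. -/
theorem wordForm_mem_powIdeal {L : Type*} [Field L] (φ : Polynomial F →+* L)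
    (hφ : Function.Injective φ) {u : Finset ℕ} (hu : m * m < u.card) (x : ℕ → Fin m) :
    (wordForm x u : (ℕ → Fin m → L) → L) ∈
      powIdeal (fun i : Fin m => φ Polynomial.X ^ (i : ℕ)) u := by
  set t : L := φ Polynomial.X with ht
  have ht0 : t ≠ 0 := (map_ne_zero_iff φ hφ).mpr Polynomial.X_ne_zero
  set lam : Fin m → L := fun i => t ^ (i : ℕ) with hlam
  choose j q hq using fun y : u → Fin m => exists_embedding_letter hu y
  set M := (degenerationMatrix (F := F) u j q).map φ with hM
  have hdet : IsUnit M.det := by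
    rw [isUnit_iff_ne_zero, hM, ← RingHom.mapMatrix_apply, ← RingHom.map_det]
    exact (map_ne_zero_iff φ hφ).mpr (det_degenerationMatrix_ne_zero u j q hq)
  have hrow (y : u → Fin m) :
      ∑ J, M y J • (wordForm (extendWord x J) u : (ℕ → Fin m → L) → L) ∈ powIdeal lam u := by
    have hg := sum_mul_prod_sub_mem_powIdeal lam (fun i => (q y (some i) : ℕ))
      (fun i k h => by simpa using (q y).injective (Subtype.ext h)) (Finset.Iio (j y))
      (fun i _ => (q y (some i)).2) {(q y none : ℕ)} (Finset.singleton_nonempty _)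
      (by simp) (fun i _ h => by
        have := (q y).injective (Subtype.ext (Finset.mem_singleton.mp h))
        cases this) (extendWord x y)
    have hexp := eq_sum_wordForm_of_mem_powIdeal x hg
    -- The row is the ideal element divided by t^j, a unit of L.
    rw [← Submodule.smul_mem_iff _ (pow_ne_zero (j y : ℕ) ht0)]
    convert hg using 1
    rw [hexp, Finset.smul_sum]
    refine Finset.sum_congr rfl fun J _ => ?_
    rw [smul_smul]
    congr 1
    simp only [wordForm_single, Finset.prod_singleton, extendWord_coe, Pi.single_apply]
    have hcond : (∀ b ∈ u \ ({(q y none : ℕ)} ∪ (Finset.Iio (j y)).image fun i =>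
        (q y (some i) : ℕ)), extendWord x J b = extendWord x y b) ↔
        ∀ b, b ≠ q y none → (∀ i < j y, b ≠ q y (some i)) → J b = y b := by
      constructor
      · intro h b hb1 hb2
        have := h b (by
          simp only [Finset.mem_sdiff, Finset.coe_mem, true_and, Finset.mem_union,
            Finset.mem_singleton, Finset.mem_image, Finset.mem_Iio, not_or, not_exists, not_and]
          exact ⟨fun h => hb1 (Subtype.ext h), fun i hi h => hb2 i hi (Subtype.ext h.symm)⟩)
        rwa [extendWord_coe, extendWord_coe] at this
      · intro h b hb
        simp only [Finset.mem_sdiff, Finset.mem_union, Finset.mem_singleton, Finset.mem_image,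
          Finset.mem_Iio, not_or, not_exists, not_and] at hb
        have := h ⟨b, hb.1⟩ (fun h => hb.2.1 (congrArg Subtype.val h))
          (fun i hi h => hb.2.2 i hi (congrArg Subtype.val h).symm)
        simpa [extendWord, hb.1] using this
    simp only [hcond]
    rw [Finset.sum_eq_single (J (q y none)) (fun l _ hl => by rw [if_neg hl, mul_zero, zero_mul])
      (by simp), if_pos rfl, mul_one]
    simp only [hM, Matrix.map_apply, degenerationMatrix, Matrix.of_apply]
    by_cases hc : ∀ b, b ≠ q y none → (∀ i < j y, b ≠ q y (some i)) → J b = y b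
    · rw [if_pos hc, mul_one]
      by_cases hj : j y ≤ J (q y none)
      · rw [if_pos ⟨hc, hj⟩, map_mul, map_pow, map_prod, ← mul_assoc, ← ht, ← pow_add,
          Nat.add_sub_cancel' (Fin.le_def.mp hj)]
        congr 1
        refine Finset.prod_congr rfl fun i _ => ?_
        rw [map_sub, apply_ite φ, apply_ite φ, map_one, map_zero]
        congr 1 <;> simp only [eq_comm]
      -- A base letter l < j makes the difference with i = l vanish.
      · rw [if_neg fun h => hj h.2, map_zero, mul_zero]
        symm
        refine mul_eq_zero_of_right _ (Finset.prod_eq_zero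
          (Finset.mem_Iio.mpr (not_le.mp hj)) (sub_self _))
    · rw [if_neg fun h => hc h.1, if_neg hc, map_zero, mul_zero, mul_zero]
  set y₀ : u → Fin m := fun b => x b
  have hx : (wordForm x u : (ℕ → Fin m → L) → L) = ∑ y, M⁻¹ y₀ y •
      ∑ J, M y J • (wordForm (extendWord x J) u : (ℕ → Fin m → L) → L) := by
    simp only [Finset.smul_sum, smul_smul]
    rw [Finset.sum_comm]
    simp only [← Finset.sum_smul, ← Matrix.mul_apply, Matrix.nonsing_inv_mul _ hdet,
      Matrix.one_apply, ite_smul, one_smul, zero_smul, Finset.sum_ite_eq, Finset.mem_univ, if_true]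
    funext v
    exact Finset.prod_congr rfl fun b hb => by simp [extendWord, hb, y₀]
  rw [hx]
  exact sum_mem fun y _ => Submodule.smul_mem _ _ (hrow y)

end Degeneration

/-! ### Existence of frames -/

section Existence

theorem mem_span_contract_of_mem_formSpace {L : Type*} [Field L] {m k : ℕ}
    {A : Matrix (Fin m) (Fin m × Fin m) L} {φ : (ℕ → Fin m → L) → L}
    (hφ : φ ∈ formSpace A (Finset.range k)) :
    (fun J : Fin k → Fin m => φ fun b => if h : b < k then Pi.single (J ⟨b, h⟩) 1 else 0) ∈
      Submodule.span L (Set.range fun c : Contraction k => contract A c) := by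
  induction hφ using Submodule.span_induction with
  | zero => exact zero_mem _
  | add f g _ _ hf hg => exact add_mem hf hg
  | smul a f _ hf => exact Submodule.smul_mem _ a hf
  | mem f hf =>
    obtain ⟨l, c, f, hf, hs, rfl⟩ := hf
    have hlt (a : Fin l) : f a < k := Finset.mem_range.mp ((hs _).mpr ⟨a, rfl⟩)
    let e : Fin l ≃ Fin k := Equiv.ofBijective (fun a => ⟨f a, hlt a⟩)
      ⟨fun a b h => hf (congrArg Fin.val h), fun b => by
        obtain ⟨a, ha⟩ := (hs b).mp (Finset.mem_range.mpr b.2)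
        exact ⟨a, Fin.ext ha⟩⟩
    refine Submodule.subset_span ⟨(Equiv.prodCongr e.symm (Equiv.refl _)).trans
      (c.trans (Equiv.sumCongr e e)), ?_⟩
    funext J
    have h1 := wiring_reindex A e c fun b => (Pi.single (J (e b)) 1 : Fin m → L)
    simp only [Equiv.apply_symm_apply] at h1
    rw [wiring_single] at h1
    simp only [h1, hlt, dif_pos]
    rfl

theorem span_contract_twistedAlg {F L : Type*} [Field F] [Field L] {m : ℕ}
    (ψ : Polynomial F →+* L) (hψ : Function.Injective ψ) {k : ℕ}
    (hk : m * m + 1 + (m * m + 1) * ((m * m + 1) * m) ≤ k) :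
    Submodule.span L (Set.range fun c : Contraction k =>
      contract (twistedAlg fun i : Fin m => ψ Polynomial.X ^ (i : ℕ)) c) = ⊤ := by
  have hX : ψ Polynomial.X ≠ 0 := (map_ne_zero_iff ψ hψ).mpr Polynomial.X_ne_zero
  have hinj : Function.Injective fun i : Fin m => ψ Polynomial.X ^ (i : ℕ) := by
    intro i j hij
    simp only [← map_pow] at hij
    have := congrArg Polynomial.natDegree (hψ hij)
    rw [Polynomial.natDegree_X_pow, Polynomial.natDegree_X_pow] at this
    exact Fin.ext this
  rw [eq_top_iff, ← (Pi.basisFun L (Fin k → Fin m)).span_eq, Submodule.span_le]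
  rintro _ ⟨x, rfl⟩
  have hk0 : 0 < k := by omega
  have h1 := wordForm_mem_formSpace (lam := fun i : Fin m => ψ Polynomial.X ^ (i : ℕ))
    (fun i => pow_ne_zero _ hX) hinj (k₁ := m * m + 1)
    (fun u x hu => wordForm_mem_powIdeal ψ hψ (by omega) x)
    (fun n => if h : n < k then x ⟨n, h⟩ else x ⟨0, hk0⟩) (Finset.range k) (by simpa using hk)
  rw [SetLike.mem_coe]
  convert mem_span_contract_of_mem_formSpace h1 using 1
  funext J
  rw [Pi.basisFun_apply, wordForm, Finset.prod_range]
  simp only [Fin.is_lt, dif_pos, Fin.eta]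
  by_cases hJ : J = x
  · subst hJ
    simp
  · obtain ⟨b, hb⟩ := Function.ne_iff.mp hJ
    rw [Pi.single_eq_of_ne hJ]
    exact (Finset.prod_eq_zero (Finset.mem_univ b) (Pi.single_eq_of_ne hb.symm 1)).symm

theorem exists_det_contractionMatrix_ne_zero {L : Type*} [Field L] {m k : ℕ}
    {A : Matrix (Fin m) (Fin m × Fin m) L}
    (h : Submodule.span L (Set.range fun c : Contraction k => contract A c) = ⊤) :
    ∃ c : (Fin k → Fin m) → Contraction k, (contractionMatrix A c).det ≠ 0 := by
  obtain ⟨f, hf, -, hli⟩ := Submodule.exists_fun_fin_finrank_span_eq L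
    (Set.range fun c : Contraction k => contract A c)
  choose c hc using hf
  have hcard : Fintype.card (Fin k → Fin m) = Fintype.card (Fin (Module.finrank L
      (Submodule.span L (Set.range fun c : Contraction k => contract A c)))) := by
    rw [h, finrank_top, Module.finrank_fintype_fun_eq_card, Fintype.card_fin]
  let e := Fintype.equivOfCardEq hcard
  refine ⟨fun r => c (e r), isUnit_iff_ne_zero.mp ((Matrix.isUnit_iff_isUnit_det _).mp
    (Matrix.linearIndependent_rows_iff_isUnit.mp ?_))⟩
  have : (contractionMatrix A fun r => c (e r)).row = f ∘ e := by
    funext r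
    exact hc (e r)
  rw [this]
  exact hli.comp e e.injective

variable {F : Type*} [Field F] {m : ℕ}

theorem det_contractionMatrix_genX_ne_zero {L : Type*} [Field L] [Algebra F L] {k : ℕ}
    {A : Matrix (Fin m) (Fin m × Fin m) L} {c : (Fin k → Fin m) → Contraction k}
    (h : (contractionMatrix A c).det ≠ 0) : (contractionMatrix (genX F m) c).det ≠ 0 := by
  let ev : Poly F m →ₐ[F] L := MvPolynomial.aeval fun q => A q.1 (q.2.1, q.2.2)
  have hA : A = (polyX F m).map (ev : Poly F m →+* L) := by
    ext i p
    simp [polyX, ev]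
  intro h0
  rw [genX, contractionMatrix_map, ← RingHom.mapMatrix_apply, ← RingHom.map_det] at h0
  have h1 := (map_eq_zero_iff _ (IsFractionRing.injective (Poly F m) (RatFun F m))).mp h0
  apply h
  rw [hA, contractionMatrix_map, ← RingHom.mapMatrix_apply, ← RingHom.map_det, h1, map_zero]

theorem tr₁_genX_ne_zero (z : Fin m) : tr₁ (genX F m) z ≠ 0 := by
  rw [genX, tr₁_map, map_ne_zero_iff _ (IsFractionRing.injective (Poly F m) (RatFun F m))]
  intro h
  have := congrArg (MvPolynomial.eval fun q : Fin m × Fin m × Fin m =>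
    if q = (z, z, z) then (1 : F) else 0) h
  simp [tr₁, polyX] at this

theorem det_genX_diag_ne_zero :
    (Matrix.of fun i j : Fin m => genX F m i (j, j)).det ≠ 0 := by
  have h1 : (Matrix.of fun i j : Fin m => genX F m i (j, j)) =
      (Matrix.of fun i j : Fin m => polyX F m i (j, j)).map
        (algebraMap (Poly F m) (RatFun F m)) := by
    ext i j
    simp [genX]
  rw [h1, ← RingHom.mapMatrix_apply, ← RingHom.map_det,
    map_ne_zero_iff _ (IsFractionRing.injective (Poly F m) (RatFun F m))]
  intro h
  have h2 := congrArg (MvPolynomial.eval fun q : Fin m × Fin m × Fin m =>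
    if q.1 = q.2.1 then (1 : F) else 0) h
  rw [RingHom.map_det, map_zero] at h2
  have h3 : (MvPolynomial.eval fun q : Fin m × Fin m × Fin m =>
      if q.1 = q.2.1 then (1 : F) else 0).mapMatrix
      (Matrix.of fun i j : Fin m => polyX F m i (j, j)) = 1 := by
    ext i j
    simp [polyX, Matrix.one_apply]
  rw [h3, Matrix.det_one] at h2
  exact one_ne_zero h2

/-- The constant columns (j, …, j) suffice: there the entries are x^i_{j,j} times a nonzero power of
Tr₁(x)_j, and det(x^i_{j,j}) is 1 at a suitable point. -/
theorem vecMul_tensorTr_genX_injective (n : ℕ) :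
    Function.Injective (tensorTr (genX F m) n).vecMul := by
  rw [Matrix.vecMul_injective_iff, Fintype.linearIndependent_iff]
  intro g hg
  suffices h : Matrix.vecMul g (Matrix.of fun i j : Fin m => genX F m i (j, j)) = 0 by
    exact fun i => congrFun (Matrix.eq_zero_of_vecMul_eq_zero det_genX_diag_ne_zero h) i
  funext j
  have h1 := congrFun hg (Fin.cons j (Fin.cons j fun _ => j))
  simp only [Finset.sum_apply, Pi.smul_apply, Matrix.row_apply, tensorTr, Matrix.of_apply,
    Fin.cons_zero, Fin.cons_one, Fin.cons_succ, smul_eq_mul, ← mul_assoc, Pi.zero_apply] at h1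
  rw [← Finset.sum_mul] at h1
  exact (mul_eq_zero.mp h1).resolve_right
    (Finset.prod_ne_zero_iff.mpr fun _ _ => tr₁_genX_ne_zero j)

/-- A matrix with linearly independent rows has an invertible maximal square submatrix. -/
theorem exists_isUnit_submatrix {K ω : Type*} [Field K] [Fintype ω] {m : ℕ}
    {B : Matrix (Fin m) ω K} (hB : LinearIndependent K B.row) :
    ∃ e : Fin m ↪ ω, IsUnit (B.submatrix id e) := by
  have hrank : Module.finrank K (Submodule.span K (Set.range B.col)) = m := by
    rw [← Matrix.rank_eq_finrank_span_cols, hB.rank_matrix, Fintype.card_fin]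
  obtain ⟨f, hf, -, hli⟩ := Submodule.exists_fun_fin_finrank_span_eq K (Set.range B.col)
  choose e he using fun i : Fin m => hf (finCongr hrank.symm i)
  have hcol : LinearIndependent K fun i => B.col (e i) := by
    simp only [he]
    exact hli.comp _ (finCongr hrank.symm).injective
  exact ⟨⟨e, fun i j h => hcol.injective (by simp only [h])⟩,
    Matrix.linearIndependent_cols_iff_isUnit.mp hcol⟩

/-- Multiplying by the invertible Q⁻¹ preserves independence of rows, so some m columns are
independent. -/
theorem exists_isFrame (n : ℕ) {c : (Fin (n + 2) → Fin m) → Contraction (n + 2)}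
    (hc : (contractionMatrix (genX F m) c).det ≠ 0) :
    ∃ P : Matrix.GeneralLinearGroup (Fin m) (RatFun F m), IsFrame F m (n + 2) P := by
  have hinj : LinearIndependent (RatFun F m)
      (tensorTr (genX F m) n * (contractionMatrix (genX F m) c)⁻¹).row := by
    rw [← Matrix.vecMul_injective_iff]
    intro v w hvw
    apply vecMul_tensorTr_genX_injective n
    have := congrArg (fun z => Matrix.vecMul z (contractionMatrix (genX F m) c)) hvw
    simpa only [Matrix.vecMul_vecMul, Matrix.mul_assoc,
      Matrix.nonsing_inv_mul _ (isUnit_iff_ne_zero.mpr hc), Matrix.mul_one] using this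
  obtain ⟨e, he⟩ := exists_isUnit_submatrix hinj
  exact ⟨he.unit⁻¹, .add_two n c hc e _ (by rw [inv_inv]; exact he.unit_spec)⟩

end Existence

end StructureConstants

theorem theorem3p2 (F : Type*) [Field F] [IsAlgClosed F] (m : ℕ) :
    (∃ k₀ : ℕ, ∀ k ≥ k₀, ∃ P : Matrix.GeneralLinearGroup (Fin m) (StructureConstants.RatFun F m),
      StructureConstants.IsFrame F m k P) ∧
    ∀ (k : ℕ) (P : Matrix.GeneralLinearGroup (Fin m) (StructureConstants.RatFun F m)),
      StructureConstants.IsFrame F m k P →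
        StructureConstants.invariantField F m =
          IntermediateField.adjoin F (Set.range fun q : Fin m × Fin m × Fin m =>
            StructureConstants.tau P (StructureConstants.genX F m) q.1 (q.2.1, q.2.2)) := by
  -- The bound is k₁ + k₁(k₁m) with k₁ = m² + 1, the length from which words lie in the ideal; the
  -- extra 2 allows k = n + 2.
  refine ⟨⟨m * m + 1 + (m * m + 1) * ((m * m + 1) * m) + 2, fun k hk => ?_⟩,
    fun k P hP => StructureConstants.invariantField_eq_adjoin hP⟩
  obtain ⟨n, rfl⟩ := Nat.exists_eq_add_of_le' (show 2 ≤ k by omega)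
  obtain ⟨c, hc⟩ := StructureConstants.exists_det_contractionMatrix_ne_zero
    (StructureConstants.span_contract_twistedAlg (m := m) (k := n + 2)
      (algebraMap (Polynomial F) (FractionRing (Polynomial F)))
      (IsFractionRing.injective _ _) (by omega))
  exact StructureConstants.exists_isFrame n
    (StructureConstants.det_contractionMatrix_genX_ne_zero hc)
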